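/- Let $K$ be a field of characteristic zero and let $\mathcal F$ be the field of formal series $a=\sum_i a_i t^{\alpha_i}$ with $a_i\in K$ and real exponents $\alpha_i$, such that only finitely many exponents of $a$ lie below any given bound. Let $\|a\|$ be the least exponent of $a\neq 0$ (and $\|0\|=\infty$), $R=\{a\in\mathcal F:\|a\|\ge 0\}$, and let $GL_r(R)$ be the group of $r\times r$ matrices over $R$ with an inverse over $R$. For $\mu\in\mathbb R^r$ put $D_\mu=\mathrm{diag}(t^{\mu_1},\dots,t^{\mu_r})$, and for $\alpha\in\mathbb R$ put $D(\alpha)=\mathrm{diag}(t^\alpha,\dots,t^\alpha)$. For index sets $I,H\subseteq\{1,\dots,r\}$ with $k$ elements, $I=\{i_1<\dots<i_k\}$, $H=\{h_1<\dots<h_k\}$, write $I\le H$ if $i_s\le h_s$ for all $s$, and $|\mu_I|=\sum_{s}\mu_{i_s}$; $W_{IJ}$ denotes the minor of a matrix $W$ with rows $I$ and columns $J$. Two pairs $(M,N)$, $(A,B)$ of invertible $r\times r$ matrices over $\mathcal F$ are in the same orbit if $(A,B)=(PMQ^{-1},QNT^{-1})$ for some $P,Q,T\in GL_r(R)$. Let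 $\mu_1\ge\dots\ge\mu_r$ be real. A matrix $N^*$ is called a $\mu$-generic matrix associated to $N'$ if it is upper triangular and $N^*=QN'T^{-1}$ with $Q,T\in GL_r(R)$, where $D_\mu QD_\mu^{-1}\in GL_r(R)$; $Q$ is both a product of an upper and a lower triangular, and a product of a lower and an upper triangular matrix in $GL_r(R)$; and, for all $k$ and all index sets with $k$ elements, $$\|(QN')_{IJ}\|\le\|(QN')_{HJ}\|\le\|(QN')_{IJ}\|+|\mu_I|-|\mu_H|\quad\text{whenever } I\le H,$$ $$\|N^*_{IJ}\|\le\|N^*_{IH}\|\quad\text{whenever } I\le H\le J.$$ A triangular array of reals $\{k_{ij}\}_{1\le i\le j\le r}$ is a right filling of the pair $(M,N)$ if there are $\mu_1\ge\dots\ge\mu_r$ and matrices $N',N^*$ such that $(D_\mu,N')$ is in the orbit of $(M,N)$, $N^*$ is a $\mu$-generic matrix associated to $N'$, and for all $1\le i\le j\le r$ $$k_{1j}+k_{2j}+\dots+k_{ij}=\omega(j-i,\,j-1)-\omega(j-i+1,\,j),$$ where $\omega(p,q)$ is the order of the minor of $N^*$ formed by all rows except those with number between $p$ and $q$, and by the right-most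 columns that make it square (the empty minor is $1$). A left filling of $(M,N)$ is obtained by interchanging the roles of rows and columns: it is a right filling of the transposed pair $(N^{T},M^{T})$. **Statement.** For every $r$ and all invertible (that is, full-rank) $r\times r$ matrices $M,N$ over $\mathcal F$ there are real numbers $\alpha,\beta$ such that the pair $(D(\beta)M,\,N\,D(\alpha))$ has a right filling and a left filling, and all parts (including the edge parts $k_{ii}$) of every right filling and of every left filling of this pair are non-negative. -/

import Mathlib

namespace LRFilling

/-- The exponents of the series `x` form a sparse set: every interval `(-∞, c]` contains only
finitely many of them, so they can be listed as a strictly increasing (finite or infinite)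
sequence of reals without limit points. -/
def SparseExponents {K : Type*} [Field K] (x : HahnSeries ℝ K) : Prop :=
  ∀ c : ℝ, (x.support ∩ Set.Iic c).Finite

section closure

variable {K : Type*} [Field K]

theorem SparseExponents.mono {x y : HahnSeries ℝ K} (hy : SparseExponents y)
    (h : x.support ⊆ y.support) : SparseExponents x := fun c =>
  (hy c).subset (Set.inter_subset_inter_left _ h)

theorem sparse_single (s : ℝ) (a : K) : SparseExponents (HahnSeries.single s a) := fun _ =>
  (Set.finite_singleton s).subset fun _ hg => HahnSeries.support_single_subset hg.1

theorem SparseExponents.add {x y : HahnSeries ℝ K} (hx : SparseExponents x)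
    (hy : SparseExponents y) : SparseExponents (x + y) := fun c =>
  ((hx c).union (hy c)).subset fun g hg => by
    rcases HahnSeries.support_add_subset x y hg.1 with h | h
    · exact Or.inl ⟨h, hg.2⟩
    · exact Or.inr ⟨h, hg.2⟩

theorem SparseExponents.neg {x : HahnSeries ℝ K} (hx : SparseExponents x) :
    SparseExponents (-x) := hx.mono (by rw [HahnSeries.support_neg])

theorem SparseExponents.mul {x y : HahnSeries ℝ K} (hx : SparseExponents x)
    (hy : SparseExponents y) : SparseExponents (x * y) := fun c => by
  refine (Set.Finite.add (hx (c - y.order)) (hy (c - x.order))).subset fun g hg => ?_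
  obtain ⟨a, ha, b, hb, hab⟩ := HahnSeries.support_mul_subset hg.1
  have h1 : x.order ≤ a := HahnSeries.order_le_of_coeff_ne_zero ha
  have h2 : y.order ≤ b := HahnSeries.order_le_of_coeff_ne_zero hb
  have h3 : g ≤ c := hg.2
  simp only at hab
  exact ⟨a, ⟨ha, by simp only [Set.mem_Iic]; linarith⟩, b,
    ⟨hb, by simp only [Set.mem_Iic]; linarith⟩, hab⟩

theorem sparse_one : SparseExponents (1 : HahnSeries ℝ K) := sparse_single 0 1

theorem SparseExponents.pow {x : HahnSeries ℝ K} (hx : SparseExponents x) (n : ℕ) :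
    SparseExponents (x ^ n) := by
  induction n with
  | zero => simpa using sparse_one
  | succ n ih => rw [pow_succ]; exact ih.mul hx

theorem sparse_sum {n : ℕ} {f : ℕ → HahnSeries ℝ K} (hf : ∀ i, SparseExponents (f i)) :
    SparseExponents (∑ i ∈ Finset.range n, f i) := by
  induction n with
  | zero => intro c; simp
  | succ n ih => rw [Finset.sum_range_succ]; exact ih.add (hf n)

/-- If `y` has only positive exponents, then `(1 - y)⁻¹` has sparse exponents: below a given bound
it agrees with a finite geometric sum. -/
theorem sparse_inv_one_sub {y : HahnSeries ℝ K} (hy : SparseExponents y)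
    (hpos : 0 < y.orderTop) : SparseExponents (1 - y)⁻¹ := by
  have hne : (1 - y) ≠ 0 := by
    intro h
    have h1 : y = 1 := (sub_eq_zero.mp h).symm
    rw [h1, HahnSeries.orderTop_one] at hpos
    exact lt_irrefl _ hpos
  by_cases hy0 : y = 0
  · subst hy0; simpa using sparse_one
  have hyo : 0 < y.order := by
    rw [← HahnSeries.order_eq_orderTop_of_ne_zero hy0] at hpos
    exact_mod_cast hpos
  intro c
  set z := (1 - y)⁻¹ with hz
  have hz0 : z ≠ 0 := inv_ne_zero hne
  obtain ⟨n, hn⟩ := exists_nat_gt ((c - z.order) / y.order)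
  have hn' : c < n * y.order + z.order := by
    rw [div_lt_iff₀ hyo] at hn; linarith
  have hdecomp : z = (∑ i ∈ Finset.range n, y ^ i) + y ^ n * z := by
    have h := geom_sum_mul_neg y n
    have h2 : (1 - y) * z = 1 := mul_inv_cancel₀ hne
    calc z = (1 - y ^ n) * z + y ^ n * z := by ring
      _ = ((∑ i ∈ Finset.range n, y ^ i) * (1 - y)) * z + y ^ n * z := by rw [h]
      _ = _ := by rw [mul_assoc, h2, mul_one]
  refine (sparse_sum (n := n) (fun i => hy.pow i) c).subset fun g hg => ⟨?_, hg.2⟩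
  have hg1 : z.coeff g ≠ 0 := hg.1
  have hg2 : g ≤ c := hg.2
  have hlt : g < (y ^ n * z).order := by
    rw [HahnSeries.order_mul (pow_ne_zero _ hy0) hz0, HahnSeries.order_pow, nsmul_eq_mul]
    linarith
  rw [hdecomp, HahnSeries.coeff_add, HahnSeries.coeff_eq_zero_of_lt_order hlt, add_zero] at hg1
  exact hg1

theorem SparseExponents.inv {x : HahnSeries ℝ K} (hx : SparseExponents x) :
    SparseExponents x⁻¹ := by
  by_cases hx0 : x = 0
  · subst hx0; simpa using hx
  set a := x.leadingCoeff with ha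
  have ha0 : a ≠ 0 := HahnSeries.leadingCoeff_ne_zero.mpr hx0
  set s : HahnSeries ℝ K := HahnSeries.single (-x.order) a⁻¹ with hs
  have hs0 : s ≠ 0 := HahnSeries.single_ne_zero (inv_ne_zero ha0)
  have hspa : SparseExponents s := sparse_single _ _
  have hsx : s * x ≠ 0 := mul_ne_zero hs0 hx0
  have ho : (s * x).order = 0 := by
    rw [HahnSeries.order_mul hs0 hx0, hs, HahnSeries.order_single (inv_ne_zero ha0)]; ring
  have hy : SparseExponents (1 - s * x) := by
    rw [sub_eq_add_neg]; exact sparse_one.add (hspa.mul hx).neg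
  have hpos : 0 < (1 - s * x).orderTop := by
    by_contra hcon
    have hne : (1 - s * x) ≠ 0 := by
      intro h; rw [h] at hcon; simp at hcon
    rw [← HahnSeries.order_eq_orderTop_of_ne_zero hne] at hcon
    have hle : (1 - s * x).order ≤ 0 := by
      have h := not_lt.mp hcon
      exact_mod_cast h
    have hc : (1 - s * x).coeff (1 - s * x).order ≠ 0 := by
      rw [← HahnSeries.leadingCoeff_eq]; exact HahnSeries.leadingCoeff_ne_zero.mpr hne
    rcases lt_or_eq_of_le hle with h | h
    · apply hc
      rw [HahnSeries.coeff_sub, HahnSeries.coeff_one, if_neg h.ne,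
        HahnSeries.coeff_eq_zero_of_lt_order (by rw [ho]; exact h), sub_zero]
    · apply hc
      have h0 : (s * x).coeff 0 = 1 := by
        have h1 := HahnSeries.coeff_single_mul_add (r := a⁻¹) (x := x) (a := x.order)
          (b := -x.order)
        rw [add_neg_cancel] at h1
        rw [hs, h1, ← HahnSeries.leadingCoeff_eq, ← ha, inv_mul_cancel₀ ha0]
      rw [h, HahnSeries.coeff_sub, HahnSeries.coeff_one, if_pos rfl, h0, sub_self]
  have hx' : x⁻¹ = s * (1 - (1 - s * x))⁻¹ := by
    rw [sub_sub_cancel, mul_inv, ← mul_assoc, mul_inv_cancel₀ hs0, one_mul]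
  rw [hx']
  exact hspa.mul (sparse_inv_one_sub hy hpos)

end closure

/-- The field `𝓕` of formal series `∑ aᵢ t^{αᵢ}` with coefficients in `K` and a strictly increasing
sequence of real exponents without limit points. -/
def seriesSubfield (K : Type*) [Field K] : Subfield (HahnSeries ℝ K) where
  carrier := {x | SparseExponents x}
  mul_mem' := SparseExponents.mul
  one_mem' := sparse_one
  add_mem' := SparseExponents.add
  zero_mem' := fun c => by simp
  neg_mem' := SparseExponents.neg
  inv_mem' := fun _ => SparseExponents.inv

/-- The field `𝓕` as a type. -/
abbrev SeriesField (K : Type*) [Field K] : Type _ := seriesSubfield K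

section

variable {K : Type*} [Field K]

/-- The order `‖a‖` of `a`: its least exponent, and `⊤` for `a = 0`. -/
noncomputable def ord (a : SeriesField K) : WithTop ℝ := (a : HahnSeries ℝ K).orderTop

/-- The monomial `t ^ s`. -/
noncomputable def tpow (K : Type*) [Field K] (s : ℝ) : SeriesField K :=
  ⟨HahnSeries.single s 1, sparse_single s 1⟩

/-- The valuation ring `R = {a : ‖a‖ ≥ 0}`. -/
def valRing (K : Type*) [Field K] : Subring (SeriesField K) where
  carrier := {a | 0 ≤ ord a}
  mul_mem' := fun {a b} ha hb => by
    show (0 : WithTop ℝ) ≤ ((a : HahnSeries ℝ K) * (b : HahnSeries ℝ K)).orderTop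
    rw [HahnSeries.orderTop_mul]
    exact add_nonneg ha hb
  one_mem' := by
    show (0 : WithTop ℝ) ≤ (1 : HahnSeries ℝ K).orderTop
    rw [HahnSeries.orderTop_one]
  add_mem' := fun {a b} ha hb => le_trans (le_min ha hb)
    (HahnSeries.min_orderTop_le_orderTop_add (x := (a : HahnSeries ℝ K)) (y := b))
  zero_mem' := by
    show (0 : WithTop ℝ) ≤ (0 : HahnSeries ℝ K).orderTop
    rw [HahnSeries.orderTop_zero]; exact le_top
  neg_mem' := fun {a} ha => by
    show (0 : WithTop ℝ) ≤ (-(a : HahnSeries ℝ K)).orderTop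
    rw [HahnSeries.orderTop_neg]; exact ha

/-- `r × r` matrices over `𝓕`. -/
abbrev Mat (r : ℕ) (K : Type*) [Field K] : Type _ := Matrix (Fin r) (Fin r) (SeriesField K)

/-- The group `GL_r(R)` of matrices over `R` with an inverse over `R`. -/
abbrev GLR (r : ℕ) (K : Type*) [Field K] : Type _ := Matrix.GeneralLinearGroup (Fin r) (valRing K)

variable {r : ℕ}

/-- An element of `GL_r(R)` as a matrix over `𝓕`. -/
def toMat (P : GLR r K) : Mat r K := (P : Matrix (Fin r) (Fin r) (valRing K)).map Subtype.val

/-- `diag(t^{μ₁}, …, t^{μ_r})`. -/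
noncomputable def diagPow (K : Type*) [Field K] (μ : Fin r → ℝ) : Mat r K :=
  Matrix.diagonal fun i => tpow K (μ i)

/-- The scalar matrix `D(α) = diag(t^α, …, t^α)`. -/
noncomputable def scalarPow (r : ℕ) (K : Type*) [Field K] (α : ℝ) : Mat r K :=
  diagPow K fun _ : Fin r => α

/-- Pair equivalence: `(A, B) = (P M Q⁻¹, Q N T⁻¹)` with `P, Q, T ∈ GL_r(R)`. -/
def PairEquiv (M N A B : Mat r K) : Prop :=
  ∃ P Q T : GLR r K, A = toMat P * M * toMat Q⁻¹ ∧ B = toMat Q * N * toMat T⁻¹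

def IsUpper (A : Mat r K) : Prop := ∀ i j, j < i → A i j = 0

def IsLower (A : Mat r K) : Prop := ∀ i j, i < j → A i j = 0

/-- `Q ∈ GL_r(R)` is `μ`-admissible: `D_μ Q D_μ⁻¹ ∈ GL_r(R)`. -/
def IsAdmissible (μ : Fin r → ℝ) (Q : GLR r K) : Prop :=
  ∃ P : GLR r K, toMat P = diagPow K μ * toMat Q * (diagPow K μ)⁻¹

/-- The order of the minor of `A` with rows `I` and columns `J`. Index sets of length `k` are
strictly increasing maps `Fin k ↪o Fin r`; they are compared entry by entry, `I s ≤ H s` for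
all `s`. -/
noncomputable def minorOrd {k : ℕ} (A : Mat r K) (I J : Fin k ↪o Fin r) : WithTop ℝ :=
  ord (A.submatrix I J).det

/-- `Nstar` is a `μ`-generic matrix associated to `N`. -/
def IsMuGeneric (μ : Fin r → ℝ) (N Nstar : Mat r K) : Prop :=
  IsUpper Nstar ∧ ∃ Q T : GLR r K,
    Nstar = toMat Q * N * toMat T⁻¹ ∧
    IsAdmissible μ Q ∧
    (∃ QU QL : GLR r K, IsUpper (toMat QU) ∧ IsLower (toMat QL) ∧ Q = QU * QL) ∧
    (∃ QL' QU' : GLR r K, IsLower (toMat QL') ∧ IsUpper (toMat QU') ∧ Q = QL' * QU') ∧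
    -- the two row inequalities, for the matrix `Q N`
    (∀ (k : ℕ) (I H J : Fin k ↪o Fin r), (∀ s, I s ≤ H s) →
      minorOrd (toMat Q * N) I J ≤ minorOrd (toMat Q * N) H J ∧
      minorOrd (toMat Q * N) H J ≤
        minorOrd (toMat Q * N) I J + ((∑ s, μ (I s) - ∑ s, μ (H s) : ℝ) : WithTop ℝ)) ∧
    -- the column inequality, for the matrix `(Q N) T⁻¹`
    (∀ (k : ℕ) (I H J : Fin k ↪o Fin r), (∀ s, I s ≤ H s) → (∀ s, H s ≤ J s) →
      minorOrd Nstar I J ≤ minorOrd Nstar I H)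

/-- The last `k` of the indices `1, …, r`. -/
def lastIdx {k : ℕ} (h : k ≤ r) : Fin k ↪o Fin r :=
  OrderEmbedding.ofStrictMono (fun s => ⟨r - k + s, by omega⟩) fun a b hab => by
    simp only [Fin.mk_lt_mk]
    have : (a : ℕ) < b := hab
    omega

/-- The order of the minor of `A` whose rows are those in `I` and whose columns are the right-most
ones. It is only used for non-zero minors. -/
noncomputable def rightOrd (A : Mat r K) (I : Finset (Fin r)) : ℝ :=
  (((A.submatrix (I.orderEmbOfFin rfl)
    (lastIdx ((Finset.card_le_univ I).trans_eq (Fintype.card_fin r)))).det : SeriesField K) :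
      HahnSeries ℝ K).order

/-- All rows, numbered `1, …, r`, except those with a number from `p` to `q`. -/
def omitRows (r p q : ℕ) : Finset (Fin r) :=
  Finset.univ.filter fun x => ¬ (p ≤ (x : ℕ) + 1 ∧ (x : ℕ) + 1 ≤ q)

/-- The parts `k i j` (for `i ≤ j`; other values are irrelevant) form the right filling of the pair
`(M, N)`: for some `μ`-generic pair `(D_μ, N^*)` in the orbit of `(M, N)`, with one-based indices,
`k_{1j} + ⋯ + k_{ij} = ‖((j-i)^, …, (j-1)^)‖ - ‖((j-i+1)^, …, j^)‖`.
With the zero-based `i j : Fin r` below, the one-based indices are `i + 1` and `j + 1`. -/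
def IsRightFilling (M N : Mat r K) (k : Fin r → Fin r → ℝ) : Prop :=
  ∃ (μ : Fin r → ℝ) (N' Nstar : Mat r K),
    Antitone μ ∧ PairEquiv M N (diagPow K μ) N' ∧ IsMuGeneric μ N' Nstar ∧
    ∀ i j : Fin r, i ≤ j →
      ∑ s ∈ Finset.Iic i, k s j =
        rightOrd Nstar (omitRows r ((j : ℕ) - i) j) -
          rightOrd Nstar (omitRows r ((j : ℕ) - i + 1) ((j : ℕ) + 1))

/-- The left filling of `(M, N)` is obtained by interchanging rows and columns, that is, by the same
construction applied to the transposed pair `(Nᵀ, Mᵀ)`. -/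
def IsLeftFilling (M N : Mat r K) (m : Fin r → Fin r → ℝ) : Prop :=
  IsRightFilling N.transpose M.transpose m

/-- All parts `k i j`, `i ≤ j`, are non-negative. -/
def AllPartsNonneg (k : Fin r → Fin r → ℝ) : Prop := ∀ i j : Fin r, i ≤ j → 0 ≤ k i j

end

end LRFilling

/-! Existence. Over the valuation ring `R`, `M` is equivalent to some `D = D_μ` with `μ` decreasing
(`exists_diagPow`). A `μ`-generic matrix then comes from `Q = (D⁻¹ C D) U` with `U` generic upper
and `C` generic lower triangular over `K`, followed by column reduction to triangular form and a
generic upper column operation (`exists_isMuGeneric`). Generic means that no lowest terms cancel in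
the expansion of any minor, so every minor of a product has the least order its terms allow. The
required inequalities thereby become comparisons of minima over nested or shifted families of index
sets. Entries `s ^ (i * r ^ j)` achieve this for all but finitely many `s` in the infinite field
`K`.

Inner parts. For `i < j`, `k i j` is a combination of at most four right-most minor orders of `N^*`.
These orders increase with the row set (`IsMuGeneric.right_minors`); together with a three-term
Plücker relation (`det_three_term`, `IsMuGeneric.three_term_le`) this makes the part non-negative,
without any scaling.

Edge parts. `k i i` compares a minor of size `n + 1` with one of size `n`. Multiplying `N` by `t^α`
adds `α` to the difference, so a large `α` suffices, provided the remaining terms are bounded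
uniformly over all fillings. The bounds come from the invariance of the least minor order under
equivalence (`exists_minor_bounds`) and from a bound on `μ i - μ j`
(`exists_invariant_factor_bound`). The latter does not depend on the scaling of `M`, so `α` for
right fillings and `β` for left fillings can be chosen independently. -/

namespace LRFilling

/-! ### The valuation on the series field -/

section basics

variable {K : Type*} [Field K] {r : ℕ}

theorem ord_zero : ord (0 : SeriesField K) = ⊤ := HahnSeries.orderTop_zero

theorem ord_one : ord (1 : SeriesField K) = 0 := HahnSeries.orderTop_one

theorem ord_eq_top_iff {a : SeriesField K} : ord a = ⊤ ↔ a = 0 := by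
  rw [ord, HahnSeries.orderTop_eq_top, ZeroMemClass.coe_eq_zero]

theorem ord_mul (a b : SeriesField K) : ord (a * b) = ord a + ord b :=
  HahnSeries.orderTop_mul (a : HahnSeries ℝ K) (b : HahnSeries ℝ K)

theorem ord_neg (a : SeriesField K) : ord (-a) = ord a :=
  HahnSeries.orderTop_neg (x := (a : HahnSeries ℝ K))

theorem le_ord_add {c : WithTop ℝ} {a b : SeriesField K} (ha : c ≤ ord a) (hb : c ≤ ord b) :
    c ≤ ord (a + b) :=
  (le_min ha hb).trans
    (HahnSeries.min_orderTop_le_orderTop_add (x := (a : HahnSeries ℝ K)) (y := b))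

theorem le_ord_sum {ι : Type*} (s : Finset ι) (f : ι → SeriesField K) {c : WithTop ℝ}
    (h : ∀ i ∈ s, c ≤ ord (f i)) : c ≤ ord (∑ i ∈ s, f i) := by
  classical
  induction s using Finset.induction_on with
  | empty => simp [ord_zero]
  | insert a s ha ih =>
    rw [Finset.sum_insert ha]
    exact le_ord_add (h a (Finset.mem_insert_self a s))
      (ih fun i hi => h i (Finset.mem_insert_of_mem hi))

theorem ord_prod {ι : Type*} (s : Finset ι) (f : ι → SeriesField K) :
    ord (∏ i ∈ s, f i) = ∑ i ∈ s, ord (f i) := by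
  classical
  induction s using Finset.induction_on with
  | empty => simp [ord_one]
  | insert a s ha ih => rw [Finset.prod_insert ha, Finset.sum_insert ha, ord_mul, ih]

theorem ord_prod_nonneg {ι : Type*} (s : Finset ι) (f : ι → SeriesField K)
    (h : ∀ i ∈ s, 0 ≤ ord (f i)) : 0 ≤ ord (∏ i ∈ s, f i) := by
  rw [ord_prod]; exact Finset.sum_nonneg h

theorem ord_inv_add {a : SeriesField K} (ha : a ≠ 0) : ord a⁻¹ + ord a = 0 := by
  rw [← ord_mul, inv_mul_cancel₀ ha, ord_one]

theorem ord_tpow (s : ℝ) : ord (tpow K s) = (s : WithTop ℝ) :=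
  HahnSeries.orderTop_single one_ne_zero

theorem tpow_zero : tpow K 0 = 1 := rfl

theorem tpow_mul_tpow (s u : ℝ) : tpow K s * tpow K u = tpow K (s + u) := by
  apply Subtype.ext
  change HahnSeries.single s (1 : K) * HahnSeries.single u 1 = HahnSeries.single (s + u) 1
  rw [HahnSeries.single_mul_single, one_mul]

theorem prod_tpow {ι : Type*} (s : Finset ι) (f : ι → ℝ) :
    ∏ i ∈ s, tpow K (f i) = tpow K (∑ i ∈ s, f i) := by
  classical
  induction s using Finset.induction_on with
  | empty => simp [tpow_zero]
  | insert a s ha ih => rw [Finset.prod_insert ha, Finset.sum_insert ha, ih, tpow_mul_tpow]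

/-- If `‖a‖ ≤ ‖b‖` then `b / a` is integral. -/
theorem ord_div_nonneg {a b : SeriesField K} (ha : a ≠ 0) (h : ord a ≤ ord b) :
    0 ≤ ord (b * a⁻¹) := by
  rw [ord_mul, ← ord_inv_add ha, add_comm]
  gcongr

theorem order_eq_of_ord {a : SeriesField K} (ha : a ≠ 0) :
    (((a : HahnSeries ℝ K).order : ℝ) : WithTop ℝ) = ord a :=
  HahnSeries.order_eq_orderTop_of_ne_zero (by simpa using ha)

/-- The constant series. -/
noncomputable def constSeries (K : Type*) [Field K] : K →+* SeriesField K :=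
  (HahnSeries.C : K →+* HahnSeries ℝ K).codRestrict (seriesSubfield K) fun a => sparse_single 0 a

theorem ord_constSeries_nonneg (a : K) : 0 ≤ ord (constSeries K a) :=
  HahnSeries.orderTop_single_le

theorem ord_constSeries {a : K} (ha : a ≠ 0) : ord (constSeries K a) = 0 :=
  HahnSeries.orderTop_single ha

theorem coeff_constSeries_mul (a : K) (x : SeriesField K) (m : ℝ) :
    ((constSeries K a * x : SeriesField K) : HahnSeries ℝ K).coeff m
      = a * (x : HahnSeries ℝ K).coeff m := by
  change ((HahnSeries.C a : HahnSeries ℝ K) * (x : HahnSeries ℝ K)).coeff m = _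
  rw [HahnSeries.C_mul_eq_smul, HahnSeries.coeff_smul, smul_eq_mul]

theorem isUnit_valRing_iff {a : valRing K} : IsUnit a ↔ ord (a : SeriesField K) = 0 := by
  constructor
  · rintro ⟨u, rfl⟩
    have h1 : ord (u.1 : SeriesField K) + ord ((u⁻¹).1 : SeriesField K) = 0 := by
      rw [← ord_mul, ← Subring.coe_mul, Units.mul_inv, Subring.coe_one, ord_one]
    have h2 : 0 ≤ ord (u.1 : SeriesField K) := u.1.2
    have h3 : 0 ≤ ord ((u⁻¹).1 : SeriesField K) := (u⁻¹).1.2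
    exact ((add_eq_zero_iff_of_nonneg h2 h3).mp h1).1
  · intro h
    have ha : (a : SeriesField K) ≠ 0 := fun h0 => by
      rw [h0, ord_zero] at h; exact absurd h (by simp)
    have hi := ord_inv_add ha
    rw [h, add_zero] at hi
    exact IsUnit.of_mul_eq_one ⟨(a : SeriesField K)⁻¹, hi.ge⟩
      (Subtype.ext (mul_inv_cancel₀ ha))

end basics

/-! ### Matrices over the valuation ring and orders of minors -/

section matrices

variable {K : Type*} [Field K] {r : ℕ}

theorem toMat_eq (P : GLR r K) :
    toMat P = (valRing K).subtype.mapMatrix (P : Matrix (Fin r) (Fin r) (valRing K)) := rfl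

theorem toMat_mul (P Q : GLR r K) : toMat (P * Q) = toMat P * toMat Q := by
  rw [toMat_eq, toMat_eq, toMat_eq, ← map_mul]; rfl

theorem toMat_one : toMat (1 : GLR r K) = 1 := by
  rw [toMat_eq, Units.val_one, map_one]

theorem toMat_mul_inv (P : GLR r K) : toMat P * toMat P⁻¹ = 1 := by
  rw [← toMat_mul, mul_inv_cancel, toMat_one]

theorem toMat_inv_mul (P : GLR r K) : toMat P⁻¹ * toMat P = 1 := by
  rw [← toMat_mul, inv_mul_cancel, toMat_one]

theorem ord_toMat_nonneg (P : GLR r K) (i j : Fin r) : 0 ≤ ord (toMat P i j) :=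
  ((P : Matrix (Fin r) (Fin r) (valRing K)) i j).2

theorem exists_toMat_eq {A : Mat r K} (h : ∀ i j, 0 ≤ ord (A i j)) (hd : ord A.det = 0) :
    ∃ P : GLR r K, toMat P = A := by
  let B : Matrix (Fin r) (Fin r) (valRing K) := Matrix.of fun i j => ⟨A i j, h i j⟩
  have hB : (valRing K).subtype.mapMatrix B = A := rfl
  have hu : IsUnit B.det := by
    rw [isUnit_valRing_iff]
    have := (valRing K).subtype.map_det B
    rw [hB] at this
    rw [← hd, ← this]; rfl
  exact ⟨Matrix.GeneralLinearGroup.mk'' B hu, hB⟩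

theorem isUnit_toMat (P : GLR r K) : IsUnit (toMat P) :=
  ⟨⟨toMat P, toMat P⁻¹, toMat_mul_inv P, toMat_inv_mul P⟩, rfl⟩

theorem ord_det_toMat (P : GLR r K) : ord (toMat P).det = 0 := by
  have hu : IsUnit (P : Matrix (Fin r) (Fin r) (valRing K)).det :=
    (Matrix.isUnit_iff_isUnit_det _).mp P.isUnit
  rw [isUnit_valRing_iff] at hu
  rw [toMat_eq, ← RingHom.map_det]; exact hu

theorem exists_toMat_eq_transpose (P : GLR r K) : ∃ Q : GLR r K, toMat Q = (toMat P).transpose :=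
  exists_toMat_eq (fun i j => ord_toMat_nonneg P j i) (by
    rw [Matrix.det_transpose, ord_det_toMat])

theorem ord_det_nonneg {n : Type*} [Fintype n] [DecidableEq n]
    {A : Matrix n n (SeriesField K)}
    (h : ∀ i j, 0 ≤ ord (A i j)) : 0 ≤ ord A.det := by
  rw [Matrix.det_apply]
  refine le_ord_sum _ _ fun σ _ => ?_
  have h1 : 0 ≤ ord (∏ i, A (σ i) i) := ord_prod_nonneg _ _ fun i _ => h _ _
  rcases Int.units_eq_one_or (Equiv.Perm.sign σ) with hs | hs <;> rw [hs]
  · simpa using h1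
  · simpa [ord_neg] using h1

/-- Column expansion of the minors of a product. -/
theorem det_submatrix_mul {m n k : Type*} [Fintype n] [DecidableEq k] [Fintype k]
    {F : Type*} [CommRing F] [DecidableEq n] {l : Type*}
    (Y : Matrix m n F) (X : Matrix n l F) (I : k → m) (J : k → l) :
    ((Y * X).submatrix I J).det =
      ∑ p : k → n, (∏ a, X (p a) (J a)) * (Y.submatrix I p).det := by
  rw [← Matrix.det_transpose]
  have h1 : ((Y * X).submatrix I J).transpose =
      fun a => ∑ q : n, X q (J a) • fun i => Y (I i) q := by
    ext a i
    simp [Matrix.mul_apply, mul_comm]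
  rw [h1]
  change (Matrix.detRowAlternating (R := F) (n := k)).toMultilinearMap _ = _
  rw [MultilinearMap.map_sum]
  refine Finset.sum_congr rfl fun p _ => ?_
  rw [MultilinearMap.map_smul_univ, smul_eq_mul]
  congr 1
  rw [← Matrix.det_transpose]; rfl

/-- The order of a minor whose rows and columns are listed by arbitrary functions. -/
noncomputable def funMinorOrd {k : ℕ} (A : Mat r K) (p q : Fin k → Fin r) : WithTop ℝ :=
  ord (A.submatrix p q).det

theorem minorOrd_eq {k : ℕ} (A : Mat r K) (I J : Fin k ↪o Fin r) :
    minorOrd A I J = funMinorOrd A I J := rfl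

theorem funMinorOrd_transpose {k : ℕ} (A : Mat r K) (p q : Fin k → Fin r) :
    funMinorOrd A.transpose p q = funMinorOrd A q p := by
  rw [funMinorOrd, ← Matrix.transpose_submatrix, Matrix.det_transpose, funMinorOrd]

theorem ord_sign_mul {k : ℕ} (σ : Equiv.Perm (Fin k)) (x : SeriesField K) :
    ord ((Equiv.Perm.sign σ : ℤ) * x : SeriesField K) = ord x := by
  rcases Int.units_eq_one_or (Equiv.Perm.sign σ) with hs | hs <;> rw [hs] <;> simp [ord_neg]

theorem funMinorOrd_perm_right {k : ℕ} (A : Mat r K) (p q : Fin k → Fin r)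
    (σ : Equiv.Perm (Fin k)) : funMinorOrd A p (q ∘ σ) = funMinorOrd A p q := by
  rw [funMinorOrd, show A.submatrix p (q ∘ σ) = (A.submatrix p q).submatrix id σ from rfl,
    Matrix.det_permute', ord_sign_mul, funMinorOrd]

theorem funMinorOrd_perm_left {k : ℕ} (A : Mat r K) (p q : Fin k → Fin r)
    (σ : Equiv.Perm (Fin k)) : funMinorOrd A (p ∘ σ) q = funMinorOrd A p q := by
  rw [← funMinorOrd_transpose, funMinorOrd_perm_right, funMinorOrd_transpose]

theorem funMinorOrd_of_not_injective_right {k : ℕ} (A : Mat r K) {p q : Fin k → Fin r}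
    (hq : ¬ Function.Injective q) : funMinorOrd A p q = ⊤ := by
  rw [Function.Injective] at hq
  push Not at hq
  obtain ⟨a, b, hab, hne⟩ := hq
  rw [funMinorOrd, ord_eq_top_iff]
  exact Matrix.det_zero_of_column_eq hne fun i => by simp [hab]

/-- An injective listing is a permutation of the increasing one. -/
theorem exists_sorted {k : ℕ} {p : Fin k → Fin r} (hp : Function.Injective p) :
    ∃ (H : Fin k ↪o Fin r) (σ : Equiv.Perm (Fin k)), p = H ∘ σ := by
  have hm : StrictMono (p ∘ Tuple.sort p) :=
    (Tuple.monotone_sort p).strictMono_of_injective (hp.comp (Tuple.sort p).injective)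
  refine ⟨OrderEmbedding.ofStrictMono _ hm, (Tuple.sort p)⁻¹, ?_⟩
  funext a
  simp [Function.comp]

theorem le_of_comp_perm_le {k : ℕ} {H J : Fin k ↪o Fin r} {σ : Equiv.Perm (Fin k)}
    (h : ∀ a, H (σ a) ≤ J a) (a : Fin k) : H a ≤ J a := by
  -- Pigeonhole: `σ` cannot map the indices up to `a` injectively into those strictly below `a`.
  -- With such a `b`, `H a ≤ H (σ b) ≤ J b ≤ J a`.
  obtain ⟨b, hb, hab⟩ : ∃ b ≤ a, a ≤ σ b := by
    by_contra hcon
    push Not at hcon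
    have h1 : (Finset.Iic a).image σ ⊆ Finset.Iio a := by
      intro x hx
      obtain ⟨b, hb, rfl⟩ := Finset.mem_image.mp hx
      exact Finset.mem_Iio.mpr (hcon b (Finset.mem_Iic.mp hb))
    have h2 := Finset.card_le_card h1
    rw [Finset.card_image_of_injective _ σ.injective] at h2
    simp at h2
  exact (H.monotone hab).trans ((h b).trans (J.monotone hb))

theorem le_of_le_comp_perm {k : ℕ} {H J : Fin k ↪o Fin r} {σ : Equiv.Perm (Fin k)}
    (h : ∀ a, J a ≤ H (σ a)) (a : Fin k) : J a ≤ H a := by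
  obtain ⟨b, hb, hab⟩ : ∃ b, a ≤ b ∧ σ b ≤ a := by
    by_contra hcon
    push Not at hcon
    have h1 : (Finset.Ici a).image σ ⊆ Finset.Ioi a := by
      intro x hx
      obtain ⟨b, hb, rfl⟩ := Finset.mem_image.mp hx
      exact Finset.mem_Ioi.mpr (hcon b (Finset.mem_Ici.mp hb))
    have h2 := Finset.card_le_card h1
    rw [Finset.card_image_of_injective _ σ.injective] at h2
    simp only [Fin.card_Ici, Fin.card_Ioi] at h2
    omega
  exact (J.monotone hb).trans ((h b).trans (H.monotone hab))

/-- Minors of an upper triangular matrix vanish unless the rows lie below the columns. -/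
theorem IsUpper.funMinorOrd_eq_top {A : Mat r K} (hA : IsUpper A) {k : ℕ}
    {I J : Fin k ↪o Fin r} (h : ¬ ∀ a, I a ≤ J a) : funMinorOrd A I J = ⊤ := by
  rw [funMinorOrd, ord_eq_top_iff, Matrix.det_apply]
  refine Finset.sum_eq_zero fun σ _ => ?_
  have : ∃ a, J a < I (σ a) := by
    by_contra hcon
    push Not at hcon
    exact h (le_of_comp_perm_le hcon)
  obtain ⟨a, ha⟩ := this
  rw [Finset.prod_eq_zero (Finset.mem_univ a) (by exact hA _ _ ha), smul_zero]

/-- Right multiplication by an integral matrix does not lower a bound for the minors. -/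
theorem le_funMinorOrd_mul_right {Y X : Mat r K} (hX : ∀ i j, 0 ≤ ord (X i j)) {k : ℕ}
    {I J : Fin k → Fin r} {c : WithTop ℝ}
    (h : ∀ p : Fin k → Fin r, c ≤ funMinorOrd Y I p) : c ≤ funMinorOrd (Y * X) I J := by
  rw [funMinorOrd, det_submatrix_mul]
  refine le_ord_sum _ _ fun p _ => ?_
  rw [ord_mul]
  exact (h p).trans (le_add_of_nonneg_left (ord_prod_nonneg _ _ fun a _ => hX _ _))

theorem le_funMinorOrd_mul_left {Y X : Mat r K} (hX : ∀ i j, 0 ≤ ord (X i j)) {k : ℕ}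
    {I J : Fin k → Fin r} {c : WithTop ℝ}
    (h : ∀ p : Fin k → Fin r, c ≤ funMinorOrd Y p J) : c ≤ funMinorOrd (X * Y) I J := by
  rw [← funMinorOrd_transpose, Matrix.transpose_mul]
  refine le_funMinorOrd_mul_right (fun i j => hX j i) fun p => ?_
  rw [funMinorOrd_transpose]; exact h p

/-- Bounds for the minors with increasing columns extend to arbitrary listings of columns. -/
theorem le_funMinorOrd_of_sorted_right {Y : Mat r K} {k : ℕ} {I : Fin k → Fin r}
    {c : WithTop ℝ} (h : ∀ J : Fin k ↪o Fin r, c ≤ funMinorOrd Y I J) (p : Fin k → Fin r) :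
    c ≤ funMinorOrd Y I p := by
  by_cases hp : Function.Injective p
  · obtain ⟨H, σ, rfl⟩ := exists_sorted hp
    rw [funMinorOrd_perm_right]; exact h H
  · rw [funMinorOrd_of_not_injective_right _ hp]; exact le_top

end matrices

/-! ### Diagonal matrices of powers of `t` -/

section diag

variable {K : Type*} [Field K] {r : ℕ}

theorem diagPow_mul_apply (μ : Fin r → ℝ) (A : Mat r K) (i j : Fin r) :
    (diagPow K μ * A) i j = tpow K (μ i) * A i j := Matrix.diagonal_mul _ _ _ _

theorem mul_diagPow_apply (μ : Fin r → ℝ) (A : Mat r K) (i j : Fin r) :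
    (A * diagPow K μ) i j = A i j * tpow K (μ j) := Matrix.mul_diagonal _ _ _ _

theorem diagPow_mul_diagPow (μ ν : Fin r → ℝ) :
    diagPow K μ * diagPow K ν = diagPow K fun i => μ i + ν i := by
  rw [diagPow, diagPow, Matrix.diagonal_mul_diagonal]
  simp only [tpow_mul_tpow]; rfl

theorem diagPow_zero : diagPow K (fun _ : Fin r => (0 : ℝ)) = 1 := by
  rw [diagPow]; simp only [tpow_zero, Matrix.diagonal_one]

theorem diagPow_inv (μ : Fin r → ℝ) : (diagPow K μ)⁻¹ = diagPow K fun i => -μ i := by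
  apply Matrix.inv_eq_left_inv
  rw [diagPow_mul_diagPow]
  simp only [neg_add_cancel, diagPow_zero]

theorem diagPow_mul_inv (μ : Fin r → ℝ) : diagPow K μ * (diagPow K μ)⁻¹ = 1 := by
  rw [diagPow_inv, diagPow_mul_diagPow]; simp only [add_neg_cancel, diagPow_zero]

theorem diagPow_inv_mul (μ : Fin r → ℝ) : (diagPow K μ)⁻¹ * diagPow K μ = 1 := by
  rw [diagPow_inv, diagPow_mul_diagPow]; simp only [neg_add_cancel, diagPow_zero]

theorem funMinorOrd_diagPow_mul (μ : Fin r → ℝ) (A : Mat r K) {k : ℕ} (p q : Fin k → Fin r) :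
    funMinorOrd (diagPow K μ * A) p q = ((∑ a, μ (p a) : ℝ) : WithTop ℝ) + funMinorOrd A p q := by
  have h : (diagPow K μ * A).submatrix p q =
      Matrix.diagonal (fun a => tpow K (μ (p a))) * A.submatrix p q := by
    ext a b
    rw [Matrix.diagonal_mul, Matrix.submatrix_apply, diagPow_mul_apply, Matrix.submatrix_apply]
  rw [funMinorOrd, h, Matrix.det_mul, Matrix.det_diagonal, ord_mul, prod_tpow, ord_tpow,
    funMinorOrd]

theorem scalarPow_mul_comm (α : ℝ) (A : Mat r K) : A * scalarPow r K α = scalarPow r K α * A := by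
  ext i j
  rw [scalarPow, mul_diagPow_apply, diagPow_mul_apply, mul_comm]

theorem transpose_diagPow (μ : Fin r → ℝ) : (diagPow K μ).transpose = diagPow K μ :=
  Matrix.diagonal_transpose _

end diag

/-! ### Generic triangular matrices -/

section generic

variable {K : Type*} [Field K] {r : ℕ}

/-- In a sum `∑ s^(e z) n_z` with distinct exponents `e z` no cancellation of the lowest terms
occurs, for all but finitely many `s`. -/
theorem finite_setOf_cancel {Z : Type*} [Fintype Z] (e : Z → ℕ) (he : Function.Injective e)
    (n : Z → SeriesField K) :
    {s : K | ¬ ∀ z, ord (∑ z, constSeries K (s ^ e z) * n z) ≤ ord (n z)}.Finite := by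
  classical
  rcases isEmpty_or_nonempty Z with hZ | hZ
  · simp
  obtain ⟨z₀, -, hz₀⟩ := Finset.exists_min_image Finset.univ (fun z => ord (n z))
    Finset.univ_nonempty
  by_cases htop : ord (n z₀) = ⊤
  · convert Set.finite_empty (α := K)
    ext s
    simp only [Set.mem_ofPred_eq, Set.mem_empty_iff_false, iff_false, not_not]
    intro z
    rw [show ord (n z) = ⊤ from top_le_iff.mp (htop ▸ hz₀ z (Finset.mem_univ z))]
    exact le_top
  obtain ⟨m, hm⟩ := WithTop.ne_top_iff_exists.mp htop
  -- `P` evaluated at `s` is the coefficient of `t^m` in the sum, `m` being the least order of the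
  -- terms. It is a non-zero polynomial since the distinct exponents keep the leading coefficient of
  -- `n z₀` separate, so only its roots are bad.
  let P : Polynomial K :=
    ∑ z, Polynomial.monomial (e z) ((n z : HahnSeries ℝ K).coeff m)
  have hP : P ≠ 0 := by
    intro h
    have h1 : P.coeff (e z₀) = (n z₀ : HahnSeries ℝ K).coeff m := by
      simp only [P, Polynomial.finsetSum_coeff, Polynomial.coeff_monomial, he.eq_iff]
      simp
    rw [h, Polynomial.coeff_zero] at h1
    exact HahnSeries.coeff_orderTop_ne (x := (n z₀ : HahnSeries ℝ K)) hm.symm h1.symm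
  refine (P.roots.toFinset.finite_toSet).subset fun s hs => ?_
  by_contra hroot
  apply hs
  intro z
  refine le_trans ?_ (hz₀ z (Finset.mem_univ z))
  rw [← hm]
  apply HahnSeries.orderTop_le_of_coeff_ne_zero
  have h2 : ((∑ z, constSeries K (s ^ e z) * n z : SeriesField K) : HahnSeries ℝ K).coeff m
      = P.eval s := by
    rw [AddSubmonoidClass.coe_finsetSum, HahnSeries.coeff_sum, Polynomial.eval_finsetSum]
    refine Finset.sum_congr rfl fun z _ => ?_
    rw [coeff_constSeries_mul, Polynomial.eval_monomial, mul_comm]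
  rw [h2]
  intro h3
  apply hroot
  simp only [Finset.mem_coe, Multiset.mem_toFinset]
  exact (Polynomial.mem_roots hP).mpr h3

/-- The matrix with entries `s ^ (i * r ^ j)` at the positions prescribed by `pat`. -/
noncomputable def powerMat (pat : Fin r → Fin r → Prop) [DecidableRel pat] (s : K) : Mat r K :=
  Matrix.of fun i j => if pat i j then constSeries K (s ^ ((i : ℕ) * r ^ (j : ℕ))) else 0

/-- Uniqueness of base `r` digits: `p a` is the digit at position `J a`, and all other digits are
`0`. This is why the entries `s ^ (i * r ^ j)` give different monomials to different terms of the
expansion of a minor. -/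
theorem digit_sum_injective {k : ℕ} {J : Fin k → Fin r} (hJ : Function.Injective J) :
    Function.Injective fun p : Fin k → Fin r => ∑ a, (p a : ℕ) * r ^ (J a : ℕ) := by
  intro p q hpq
  rcases Nat.eq_zero_or_pos r with h0 | hr
  · subst h0; funext a; exact (p a).elim0
  let E : (Fin k → Fin r) → Fin r → Fin r := fun p => Function.extend J p fun _ => ⟨0, hr⟩
  have hE : ∀ p, (finFunctionFinEquiv (E p) : ℕ) = ∑ a, (p a : ℕ) * r ^ (J a : ℕ) := by
    intro p
    rw [finFunctionFinEquiv_apply]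
    symm
    rw [← Finset.sum_subset (Finset.subset_univ (Finset.univ.map ⟨J, hJ⟩)), Finset.sum_map]
    · simp [E, hJ.extend_apply]
    · intro x _ hx
      have : ¬ ∃ a, J a = x := fun ⟨a, ha⟩ => hx (by simp [← ha])
      simp [E, Function.extend_apply' _ _ _ this]
  have h1 : E p = E q := finFunctionFinEquiv.injective (Fin.ext (by rw [hE, hE]; exact hpq))
  funext a
  have := congrFun h1 (J a)
  simpa [E, hJ.extend_apply] using this

theorem finite_setOf_not_generic (pat : Fin r → Fin r → Prop) [DecidableRel pat] (Y : Mat r K) :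
    {s : K | ¬ ∀ (k : ℕ) (I J : Fin k ↪o Fin r) (p : Fin k → Fin r), (∀ a, pat (p a) (J a)) →
      funMinorOrd (Y * powerMat pat s) I J ≤ funMinorOrd Y I p}.Finite := by
  classical
  have key : ∀ (k : ℕ) (I J : Fin k ↪o Fin r), {s : K | ¬ ∀ p : Fin k → Fin r,
      (∀ a, pat (p a) (J a)) →
      funMinorOrd (Y * powerMat pat s) I J ≤ funMinorOrd Y I p}.Finite := by
    intro k I J
    refine (finite_setOf_cancel (fun p : Fin k → Fin r => ∑ a, (p a : ℕ) * r ^ (J a : ℕ))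
      (digit_sum_injective J.injective)
      (fun p => if ∀ a, pat (p a) (J a) then (Y.submatrix I p).det else 0)).subset ?_
    intro s hs h
    apply hs
    intro p hp
    have h1 := h p
    rw [if_pos hp] at h1
    refine le_trans (le_of_eq ?_) h1
    rw [funMinorOrd, det_submatrix_mul]
    congr 1
    refine Finset.sum_congr rfl fun q _ => ?_
    split_ifs with hq
    · congr 1
      rw [← Finset.prod_pow_eq_pow_sum, map_prod]
      refine Finset.prod_congr rfl fun a _ => ?_
      simp [powerMat, hq a]
    · push Not at hq
      obtain ⟨a, ha⟩ := hq
      rw [Finset.prod_eq_zero (Finset.mem_univ a) (by simp [powerMat, ha]), zero_mul, mul_zero]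
  -- There are no embeddings `Fin k ↪o Fin r` for `k > r`, so finitely many finite exceptional sets
  -- cover all sizes.
  have hfin : (⋃ k ∈ Finset.range (r + 1), ⋃ (I : Fin k ↪o Fin r), ⋃ (J : Fin k ↪o Fin r),
      {s : K | ¬ ∀ p : Fin k → Fin r, (∀ a, pat (p a) (J a)) →
      funMinorOrd (Y * powerMat pat s) I J ≤ funMinorOrd Y I p}).Finite :=
    Set.Finite.biUnion (Finset.finite_toSet _) fun k _ => Set.finite_iUnion fun I =>
      Set.finite_iUnion fun J => key k I J
  refine hfin.subset fun s hs => ?_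
  rw [Set.mem_ofPred_eq] at hs
  push Not at hs
  obtain ⟨k, I, J, p, hp, hlt⟩ := hs
  have hk : k ≤ r := by simpa using Fintype.card_le_of_injective I I.injective
  simp only [Set.mem_iUnion]
  exact ⟨k, Finset.mem_range.mpr (by omega), I, J, fun h => absurd (h p hp) (not_le.mpr hlt)⟩

theorem le_funMinorOrd_mul_powerMat (pat : Fin r → Fin r → Prop) [DecidableRel pat] (Y : Mat r K)
    (s : K) {k : ℕ} {I J : Fin k → Fin r} {c : WithTop ℝ}
    (h : ∀ p : Fin k → Fin r, (∀ a, pat (p a) (J a)) → c ≤ funMinorOrd Y I p) :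
    c ≤ funMinorOrd (Y * powerMat pat s) I J := by
  rw [funMinorOrd, det_submatrix_mul]
  refine le_ord_sum _ _ fun p _ => ?_
  by_cases hp : ∀ a, pat (p a) (J a)
  · rw [ord_mul]
    refine (h p hp).trans (le_add_of_nonneg_left (ord_prod_nonneg _ _ fun a _ => ?_))
    rw [powerMat, Matrix.of_apply, if_pos (hp a)]
    exact ord_constSeries_nonneg _
  · push Not at hp
    obtain ⟨a, ha⟩ := hp
    rw [Finset.prod_eq_zero (Finset.mem_univ a) (by simp [powerMat, ha]), zero_mul, ord_zero]
    exact le_top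

/-- Properties of a generic upper triangular matrix `X`: each minor of `Y₁ X` and of `Y₂ X` has the
least order that the minors of `Y₁` and of `Y₂` allow. -/
theorem exists_generic_upper [Infinite K] (Y₁ Y₂ : Mat r K) :
    ∃ X : GLR r K, IsUpper (toMat X) ∧ ∀ Y : Mat r K, (Y = Y₁ ∨ Y = Y₂) →
      ∀ (k : ℕ) (I J : Fin k ↪o Fin r),
        (∀ H : Fin k ↪o Fin r, (∀ a, H a ≤ J a) →
          funMinorOrd (Y * toMat X) I J ≤ funMinorOrd Y I H) ∧
        ∀ c : WithTop ℝ, (∀ H : Fin k ↪o Fin r, (∀ a, H a ≤ J a) → c ≤ funMinorOrd Y I H) →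
          c ≤ funMinorOrd (Y * toMat X) I J := by
  -- The value `s = 0` is avoided as well, so that the diagonal entries have order `0` and the
  -- triangular matrix lies in `GL_r(R)`.
  obtain ⟨s, hs⟩ := (((finite_setOf_not_generic (· ≤ ·) Y₁).union
    (finite_setOf_not_generic (· ≤ ·) Y₂)).union (Set.finite_singleton (0 : K))).exists_notMem
  simp only [Set.mem_union, Set.mem_ofPred_eq, not_or, not_not, Set.mem_singleton_iff] at hs
  obtain ⟨⟨h1, h2⟩, h0⟩ := hs
  obtain ⟨X, hX⟩ : ∃ X : GLR r K, toMat X = powerMat (· ≤ ·) s := by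
    refine exists_toMat_eq (fun i j => ?_) ?_
    · rw [powerMat, Matrix.of_apply]
      split_ifs
      · exact ord_constSeries_nonneg _
      · rw [ord_zero]; exact le_top
    · rw [Matrix.det_of_isUpperTriangular, ord_prod]
      · refine Finset.sum_eq_zero fun i _ => ?_
        rw [powerMat, Matrix.of_apply, if_pos le_rfl]
        exact ord_constSeries (pow_ne_zero _ h0)
      · intro i j hij
        exact if_neg (not_le.mpr hij)
  refine ⟨X, fun i j hij => by rw [hX]; exact if_neg (not_le.mpr hij), ?_⟩
  rintro Y hY k I J
  constructor
  · intro H hH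
    rw [hX]
    rcases hY with rfl | rfl
    · exact h1 k I J H hH
    · exact h2 k I J H hH
  · intro c hc
    rw [hX]
    refine le_funMinorOrd_mul_powerMat _ _ _ fun p hp => ?_
    by_cases hinj : Function.Injective p
    · obtain ⟨H, σ, rfl⟩ := exists_sorted hinj
      rw [funMinorOrd_perm_right]
      exact hc H (le_of_comp_perm_le hp)
    · rw [funMinorOrd_of_not_injective_right _ hinj]; exact le_top

/-- The same for a generic lower triangular matrix. -/
theorem exists_generic_lower [Infinite K] (Y₁ Y₂ : Mat r K) :
    ∃ X : GLR r K, IsLower (toMat X) ∧ ∀ Y : Mat r K, (Y = Y₁ ∨ Y = Y₂) →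
      ∀ (k : ℕ) (I J : Fin k ↪o Fin r),
        (∀ H : Fin k ↪o Fin r, (∀ a, J a ≤ H a) →
          funMinorOrd (Y * toMat X) I J ≤ funMinorOrd Y I H) ∧
        ∀ c : WithTop ℝ, (∀ H : Fin k ↪o Fin r, (∀ a, J a ≤ H a) → c ≤ funMinorOrd Y I H) →
          c ≤ funMinorOrd (Y * toMat X) I J := by
  obtain ⟨s, hs⟩ := (((finite_setOf_not_generic (· ≥ ·) Y₁).union
    (finite_setOf_not_generic (· ≥ ·) Y₂)).union (Set.finite_singleton (0 : K))).exists_notMem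
  simp only [Set.mem_union, Set.mem_ofPred_eq, not_or, not_not, Set.mem_singleton_iff] at hs
  obtain ⟨⟨h1, h2⟩, h0⟩ := hs
  obtain ⟨X, hX⟩ : ∃ X : GLR r K, toMat X = powerMat (· ≥ ·) s := by
    refine exists_toMat_eq (fun i j => ?_) ?_
    · rw [powerMat, Matrix.of_apply]
      split_ifs
      · exact ord_constSeries_nonneg _
      · rw [ord_zero]; exact le_top
    · rw [Matrix.det_of_isLowerTriangular, ord_prod]
      · refine Finset.sum_eq_zero fun i _ => ?_
        rw [powerMat, Matrix.of_apply, if_pos le_rfl]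
        exact ord_constSeries (pow_ne_zero _ h0)
      · intro i j hij
        exact if_neg (not_le.mpr hij)
  refine ⟨X, fun i j hij => by rw [hX]; exact if_neg (not_le.mpr hij), ?_⟩
  rintro Y hY k I J
  constructor
  · intro H hH
    rw [hX]
    rcases hY with rfl | rfl
    · exact h1 k I J H hH
    · exact h2 k I J H hH
  · intro c hc
    rw [hX]
    refine le_funMinorOrd_mul_powerMat _ _ _ fun p hp => ?_
    by_cases hinj : Function.Injective p
    · obtain ⟨H, σ, rfl⟩ := exists_sorted hinj
      rw [funMinorOrd_perm_right]
      exact hc H (le_of_le_comp_perm hp)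
    · rw [funMinorOrd_of_not_injective_right _ hinj]; exact le_top

end generic

/-! ### Elimination over `R`, triangular factorizations and invariant factors -/

section elimination

variable {K : Type*} [Field K] {r : ℕ}

theorem exists_toMat_eq_of_mul_eq_one {A B : Mat r K} (hA : ∀ i j, 0 ≤ ord (A i j))
    (hB : ∀ i j, 0 ≤ ord (B i j)) (h : A * B = 1) : ∃ P : GLR r K, toMat P = A := by
  refine exists_toMat_eq hA ?_
  have h1 : ord A.det + ord B.det = 0 := by
    rw [← ord_mul, ← Matrix.det_mul, h, Matrix.det_one, ord_one]
  exact ((add_eq_zero_iff_of_nonneg (ord_det_nonneg hA) (ord_det_nonneg hB)).mp h1).1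

theorem ord_one_apply_nonneg (i j : Fin r) : 0 ≤ ord ((1 : Mat r K) i j) := by
  rw [← toMat_one]; exact ord_toMat_nonneg _ _ _

/-- Permutations of the columns. -/
theorem exists_permute_columns (σ : Equiv.Perm (Fin r)) :
    ∃ P : GLR r K, ∀ A : Mat r K, A * toMat P = A.submatrix id σ := by
  have h : ∀ (τ : Equiv.Perm (Fin r)) (A : Mat r K),
      A * (1 : Mat r K).submatrix id τ = A.submatrix id τ := by
    intro τ A
    ext i j
    simp [Matrix.mul_apply, Matrix.one_apply]
  obtain ⟨P, hP⟩ := exists_toMat_eq_of_mul_eq_one (A := (1 : Mat r K).submatrix id σ)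
    (B := (1 : Mat r K).submatrix id (σ⁻¹ : Equiv.Perm (Fin r))) (fun i j => ord_one_apply_nonneg _ _)
    (fun i j => ord_one_apply_nonneg _ _) (by
      rw [h, Matrix.submatrix_submatrix]
      have h1 : (σ⁻¹ : Equiv.Perm (Fin r)) = σ.symm := rfl
      rw [h1, Equiv.self_comp_symm, Function.comp_id, Matrix.submatrix_id_id])
  exact ⟨P, fun A => by rw [hP, h]⟩

/-- Multiples of column `c` can be added to the columns in `S` in order to clear row `c`. -/
theorem exists_eliminate (A : Mat r K) (c : Fin r) (S : Fin r → Prop) (hc : ¬ S c)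
    (h : ∀ j, S j → ord (A c c) ≤ ord (A c j)) :
    ∃ E : GLR r K, (∀ i, A i c = 0 → ∀ j, (A * toMat E) i j = A i j) ∧
      (∀ i j, ¬ S j → (A * toMat E) i j = A i j) ∧
      (∀ j, S j → (A * toMat E) c j = 0) ∧
      ∀ i j, i ≠ j → ¬ (i = c ∧ S j) → toMat E i j = 0 := by
  classical
  -- If `A c c = 0`, the bound `h` forces row `c` to vanish on `S`, and `0⁻¹ = 0` makes `x` zero, so
  -- nothing needs to be cleared.
  let x : Fin r → SeriesField K := fun j => if S j then -(A c j * (A c c)⁻¹) else 0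
  have hx : ∀ j, 0 ≤ ord (x j) := by
    intro j
    by_cases hj : S j
    · simp only [x, if_pos hj, ord_neg]
      by_cases h0 : A c c = 0
      · simp [h0, ord_zero]
      · exact ord_div_nonneg h0 (h j hj)
    · simp [x, if_neg hj, ord_zero]
  have hxc : x c = 0 := if_neg hc
  -- Since `x c = 0`, the rank-one perturbations `R x` and `R (-x)` of the identity are inverse to
  -- each other.
  let R : (Fin r → SeriesField K) → Mat r K := fun y =>
    Matrix.of fun i j => (1 : Mat r K) i j + if i = c then y j else 0
  have hmul : ∀ (B : Mat r K) y i j, (B * R y) i j = B i j + B i c * y j := by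
    intro B y i j
    simp [R, Matrix.mul_apply, mul_add, Finset.sum_add_distrib, Matrix.one_apply]
  obtain ⟨E, hE⟩ := exists_toMat_eq_of_mul_eq_one (A := R x) (B := R (-x))
    (fun i j => by
      refine le_ord_add (ord_one_apply_nonneg i j) ?_
      split_ifs
      · exact hx j
      · simp [ord_zero])
    (fun i j => by
      refine le_ord_add (ord_one_apply_nonneg i j) ?_
      split_ifs
      · rw [Pi.neg_apply, ord_neg]; exact hx j
      · simp [ord_zero]) (by
      ext i j : 2
      rw [hmul]
      by_cases hi : i = c <;> simp [R, hi, hxc, Matrix.one_apply])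
  refine ⟨E, fun i hi j => ?_, fun i j hj => ?_, fun j hj => ?_, fun i j hij hn => ?_⟩
  · rw [hE, hmul, hi, zero_mul, add_zero]
  · rw [hE, hmul, show x j = 0 from if_neg hj, mul_zero, add_zero]
  · rw [hE, hmul, show x j = -(A c j * (A c c)⁻¹) from if_pos hj]
    by_cases h0 : A c c = 0
    · have := h j hj
      rw [h0, ord_zero, top_le_iff, ord_eq_top_iff] at this
      rw [h0, this]; simp
    · field_simp; ring
  · rw [hE]
    simp only [R, Matrix.of_apply, Matrix.one_apply_ne hij, zero_add]
    by_cases hi : i = c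
    · rw [if_pos hi]; exact if_neg fun hj => hn ⟨hi, hj⟩
    · exact if_neg hi

/-- Column reduction to upper triangular form. -/
theorem exists_mul_isUpper (W : Mat r K) : ∃ T : GLR r K, IsUpper (W * toMat T) := by
  have key : ∀ n ≤ r, ∃ T : GLR r K, ∀ i j : Fin r, j < i → r - n ≤ (i : ℕ) →
      (W * toMat T) i j = 0 := by
    intro n
    induction n with
    | zero => intro _; exact ⟨1, fun i j _ h => absurd i.2 (by omega)⟩
    | succ n ih =>
      intro hn
      obtain ⟨T, hT⟩ := ih (by omega)
      set A := W * toMat T with hA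
      let c : Fin r := ⟨r - (n + 1), by omega⟩
      -- Rows are cleared from the bottom up. An entry of least order serves as pivot, so that the
      -- quotients used for clearing stay in `R`.
      obtain ⟨j₀, hj₀, hmin⟩ := Finset.exists_min_image (Finset.Iic c) (fun j => ord (A c j))
        ⟨c, Finset.mem_Iic.mpr le_rfl⟩
      rw [Finset.mem_Iic] at hj₀
      have hswap : ∀ i j : Fin r, c ≤ i → j ≤ i → Equiv.swap j₀ c j ≤ i := by
        intro i j hi hj
        rw [Equiv.swap_apply_def]
        split_ifs
        · exact hi
        · exact hj₀.trans hi
        · exact hj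
      obtain ⟨S, hS⟩ := exists_permute_columns (K := K) (Equiv.swap j₀ c)
      obtain ⟨E, hE1, -, hE3, -⟩ := exists_eliminate (A * toMat S) c (· < c) (lt_irrefl c) (by
        intro j hj
        simp only [hS, Matrix.submatrix_apply, id, Equiv.swap_apply_right]
        exact hmin _ (Finset.mem_Iic.mpr (hswap c j le_rfl hj.le)))
      refine ⟨T * S * E, fun i j hji hi => ?_⟩
      rw [toMat_mul, toMat_mul, ← Matrix.mul_assoc, ← Matrix.mul_assoc, ← hA]
      rcases eq_or_ne i c with rfl | hic
      · exact hE3 j hji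
      · have hci : c < i := lt_of_le_of_ne (show r - (n + 1) ≤ (i : ℕ) from hi) hic.symm
        have hin : r - n ≤ (i : ℕ) := by
          have : r - (n + 1) < (i : ℕ) := hci
          omega
        have hz : ∀ j < i, (A * toMat S) i j = 0 := by
          intro j hj
          simp only [hS, Matrix.submatrix_apply, id]
          refine hT i _ (lt_of_le_of_ne (hswap i j hci.le hj.le) ?_) hin
          rw [Equiv.swap_apply_def]
          split_ifs with h1 h2
          · exact hci.ne
          · exact (hj₀.trans_lt hci).ne
          · exact hj.ne
        rw [hE1 i (hz c hci), hz j hji]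
  obtain ⟨T, hT⟩ := key r le_rfl
  exact ⟨T, fun i j hij => hT i j hij (by omega)⟩

/-- The block of `A` formed by the rows and columns from `c` on. -/
abbrev trailingBlock (A : Mat r K) (c : Fin r) :
    Matrix {i : Fin r // c ≤ i} {i : Fin r // c ≤ i} (SeriesField K) :=
  A.submatrix Subtype.val Subtype.val

theorem IsLower.det_trailingBlock {A : Mat r K} (hA : IsLower A) (c : Fin r) :
    (trailingBlock A c).det = ∏ i : {i : Fin r // c ≤ i}, A i i :=
  Matrix.det_of_isLowerTriangular _ fun i j hij => hA i j hij

/-- The columns of `B` from `c` on vanish in the rows before `c`. Hence lower triangular column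
operations with unit diagonal keep the orders of the trailing principal minors. -/
theorem IsLower.trailingBlock_mul {B : Mat r K} (hB : IsLower B) (A : Mat r K) (c : Fin r) :
    trailingBlock (A * B) c = trailingBlock A c * trailingBlock B c := by
  ext i j : 1
  change (A * B) i j = _
  rw [Matrix.mul_apply, Matrix.mul_apply]
  refine Eq.trans ?_ (Finset.sum_subtype (p := fun l => c ≤ l) (Finset.Ici c)
    (fun l => Finset.mem_Ici) fun l => A i l * B l j)
  symm
  refine Finset.sum_subset (Finset.subset_univ _) fun l _ hl => ?_
  rw [Finset.mem_Ici, not_le] at hl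
  rw [hB l j (hl.trans_le j.2), mul_zero]

theorem IsLower.det {A : Mat r K} (hA : IsLower A) : A.det = ∏ i, A i i :=
  Matrix.det_of_isLowerTriangular _ fun i j hij => hA i j hij

theorem IsLower.ord_apply_self {T : GLR r K} (hT : IsLower (toMat T)) (i : Fin r) :
    ord (toMat T i i) = 0 := by
  have h := ord_det_toMat T
  rw [hT.det, ord_prod,
    Finset.sum_eq_zero_iff_of_nonneg fun i _ => ord_toMat_nonneg T i i] at h
  exact h i (Finset.mem_univ i)

theorem IsLower.mul {A B : Mat r K} (hA : IsLower A) (hB : IsLower B) : IsLower (A * B) := by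
  intro i j hij
  rw [Matrix.mul_apply]
  refine Finset.sum_eq_zero fun l _ => ?_
  rcases lt_or_ge i l with h | h
  · rw [hA i l h, zero_mul]
  · rw [hB l j (h.trans_lt hij), mul_zero]

theorem IsLower.toMat_inv {T : GLR r K} (hT : IsLower (toMat T)) : IsLower (toMat T⁻¹) := by
  have h : toMat T⁻¹ = (toMat T)⁻¹ := (Matrix.inv_eq_left_inv (toMat_inv_mul T)).symm
  let := Matrix.invertibleOfIsUnitDet _ ((Matrix.isUnit_iff_isUnit_det _).mp (isUnit_toMat T))
  rw [h]
  exact fun i j hij => Matrix.blockTriangular_inv_of_blockTriangular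
    (M := toMat T) (b := OrderDual.toDual) (fun i j hij => hT i j hij) hij

/-- A matrix over `R` whose lower right principal minors are units is the product of an upper and
a lower triangular matrix in `GL_r(R)`. -/
theorem exists_upper_mul_lower (Q : GLR r K)
    (hQ : ∀ c : Fin r, ord (trailingBlock (toMat Q) c).det = 0) :
    ∃ QU QL : GLR r K, IsUpper (toMat QU) ∧ IsLower (toMat QL) ∧ Q = QU * QL := by
  have key : ∀ n ≤ r, ∃ T : GLR r K, IsLower (toMat T) ∧ ∀ i j : Fin r, j < i → r - n ≤ (i : ℕ) →
      toMat (Q * T) i j = 0 := by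
    intro n
    induction n with
    | zero =>
      intro _
      exact ⟨1, fun i j hij => by rw [toMat_one, Matrix.one_apply_ne hij.ne],
        fun i j _ h => absurd i.2 (by omega)⟩
    | succ n ih =>
      intro hn
      obtain ⟨T, hTl, hT⟩ := ih (by omega)
      let c : Fin r := ⟨r - (n + 1), by omega⟩
      -- The trailing block of `Q * T` at `c` is already upper triangular with determinant of order
      -- `0`; its diagonal entries are integral, so each has order `0`. The pivot is thus a unit and
      -- no column exchange is needed.
      have hcc : ord (toMat (Q * T) c c) = 0 := by
        have h2 : ord (trailingBlock (toMat (Q * T)) c).det = 0 := by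
          rw [toMat_mul, hTl.trailingBlock_mul, Matrix.det_mul, ord_mul, hQ,
            hTl.det_trailingBlock, ord_prod, zero_add]
          exact Finset.sum_eq_zero fun i _ => hTl.ord_apply_self i
        rw [Matrix.det_of_isUpperTriangular, ord_prod, Finset.sum_eq_zero_iff_of_nonneg] at h2
        · exact h2 ⟨c, le_rfl⟩ (Finset.mem_univ _)
        · exact fun i _ => ord_toMat_nonneg (Q * T) i i
        · intro i j hij
          have hij' : (j : Fin r) < i := hij
          refine hT i j hij' ?_
          have h3 : (c : ℕ) < (i : Fin r) := lt_of_le_of_lt (show (c : ℕ) ≤ (j : Fin r) from j.2) hij'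
          change r - (n + 1) < (i : Fin r).val at h3
          omega
      obtain ⟨E, hE1, -, hE3, hE4⟩ := exists_eliminate (toMat (Q * T)) c (· < c) (lt_irrefl c)
        fun j _ => by rw [hcc]; exact ord_toMat_nonneg _ _ _
      refine ⟨T * E, ?_, fun i j hji hi => ?_⟩
      · rw [toMat_mul]
        refine hTl.mul fun i j hij => hE4 i j hij.ne ?_
        rintro ⟨rfl, hj⟩
        exact absurd hj (not_lt.mpr hij.le)
      · rw [← mul_assoc, toMat_mul]
        rcases eq_or_ne i c with rfl | hic
        · exact hE3 j hji
        · have hci : c < i := lt_of_le_of_ne (show r - (n + 1) ≤ (i : ℕ) from hi) hic.symm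
          have hin : r - n ≤ (i : ℕ) := by
            have : r - (n + 1) < (i : ℕ) := hci
            omega
          rw [hE1 i (hT i c hci hin), hT i j hji hin]
  obtain ⟨T, hTl, hT⟩ := key r le_rfl
  exact ⟨Q * T, T⁻¹, fun i j hij => hT i j hij (by omega), hTl.toMat_inv, by simp⟩

/-- Smith reduction over a valuation ring: an entry of least order in the remaining block divides
all the others, so moving it to the corner lets its row and column be cleared. -/
theorem exists_diagonal (M : Mat r K) : ∃ (P Q : GLR r K) (d : Fin r → SeriesField K),
    toMat P * M * toMat Q = Matrix.diagonal d := by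
  have key : ∀ n ≤ r, ∃ P Q : GLR r K, ∀ i j : Fin r, i ≠ j → ((i : ℕ) < n ∨ (j : ℕ) < n) →
      (toMat P * M * toMat Q) i j = 0 := by
    intro n
    induction n with
    | zero => intro _; exact ⟨1, 1, fun i j _ h => absurd h (by omega)⟩
    | succ n ih =>
      intro hn
      obtain ⟨P, Q, hPQ⟩ := ih (by omega)
      set A := toMat P * M * toMat Q with hA
      let c : Fin r := ⟨n, by omega⟩
      obtain ⟨⟨i₀, j₀⟩, hm, hmin⟩ := Finset.exists_min_image (Finset.Ici c ×ˢ Finset.Ici c)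
        (fun z => ord (A z.1 z.2)) ⟨(c, c), by simp⟩
      simp only [Finset.mem_product, Finset.mem_Ici] at hm
      obtain ⟨hi₀, hj₀⟩ := hm
      have hswap : ∀ x y : Fin r, c ≤ x → c ≤ y → c ≤ Equiv.swap x c y := by
        intro x y hx hy
        rw [Equiv.swap_apply_def]
        split_ifs
        · exact le_rfl
        · exact hx
        · exact hy
      have hswap' : ∀ x y : Fin r, c ≤ x → y < c → Equiv.swap x c y = y := by
        intro x y hx hy
        exact Equiv.swap_apply_of_ne_of_ne (hy.trans_le hx).ne hy.ne
      obtain ⟨S₁, hS₁⟩ := exists_permute_columns (K := K) (Equiv.swap i₀ c)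
      obtain ⟨S₂, hS₂⟩ := exists_permute_columns (K := K) (Equiv.swap j₀ c)
      obtain ⟨S₃, hS₃⟩ := exists_toMat_eq_transpose S₁
      have hB : toMat S₃ * A * toMat S₂ = A.submatrix (Equiv.swap i₀ c) (Equiv.swap j₀ c) := by
        rw [hS₂, hS₃, ← Matrix.transpose_transpose A, ← Matrix.transpose_mul, hS₁]
        rfl
      set B := toMat S₃ * A * toMat S₂ with hBdef
      have hB0 : ∀ i j, i ≠ j → (i < c ∨ j < c) → B i j = 0 := by
        intro i j hij h
        rw [hB, Matrix.submatrix_apply]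
        have hlt : ∀ x : Fin r, c ≤ x → ∀ y z, y < c → c ≤ z → y ≠ Equiv.swap x c z :=
          fun x hx y z hy hz => (hy.trans_le (hswap x z hx hz)).ne
        rcases lt_or_ge i c with hi | hi <;> rcases lt_or_ge j c with hj | hj
        · rw [hswap' _ _ hi₀ hi, hswap' _ _ hj₀ hj]; exact hPQ _ _ hij (Or.inl hi)
        · rw [hswap' _ _ hi₀ hi]; exact hPQ _ _ (hlt _ hj₀ _ _ hi hj) (Or.inl hi)
        · rw [hswap' _ _ hj₀ hj]; exact hPQ _ _ (hlt _ hi₀ _ _ hj hi).symm (Or.inr hj)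
        · exact absurd h (by simp [hi, hj])
      have hBmin : ∀ i j, c ≤ i → c ≤ j → ord (B c c) ≤ ord (B i j) := by
        intro i j hi hj
        rw [hB, Matrix.submatrix_apply, Matrix.submatrix_apply, Equiv.swap_apply_right,
          Equiv.swap_apply_right]
        exact hmin (_, _) (Finset.mem_product.mpr ⟨Finset.mem_Ici.mpr (hswap _ _ hi₀ hi),
          Finset.mem_Ici.mpr (hswap _ _ hj₀ hj)⟩)
      obtain ⟨E, hE1, hE2, hE3, -⟩ := exists_eliminate B c (c < ·) (lt_irrefl c)
        fun j hj => hBmin c j le_rfl hj.le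
      set C := B * toMat E with hC
      have hC0 : ∀ i j, i ≠ j → (i < c ∨ j < c) → C i j = 0 := by
        intro i j hij h
        by_cases hj : c < j
        · rw [hE1 i (hB0 i c ?_ (Or.inl ?_)) j, hB0 i j hij h]
          · rintro rfl; exact absurd h (by simp [hj.le])
          · exact h.resolve_right (not_lt.mpr hj.le)
        · rw [hE2 i j hj, hB0 i j hij h]
      have hCc : ∀ j, j ≠ c → C c j = 0 := by
        intro j hj
        rcases lt_or_gt_of_ne hj with h | h
        · exact hC0 c j hj.symm (Or.inr h)
        · exact hE3 j h
      obtain ⟨E', hE1', hE2', hE3', -⟩ := exists_eliminate C.transpose c (c < ·) (lt_irrefl c)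
        fun j hj => by
          rw [Matrix.transpose_apply, Matrix.transpose_apply, hE2 _ _ (lt_irrefl c),
            hE2 _ _ (lt_irrefl c)]
          exact hBmin j c hj.le le_rfl
      obtain ⟨E'', hE''⟩ := exists_toMat_eq_transpose E'
      refine ⟨E'' * S₃ * P, Q * S₂ * E, fun i j hij h => ?_⟩
      have hfin : toMat (E'' * S₃ * P) * M * toMat (Q * S₂ * E) =
          (C.transpose * toMat E').transpose := by
        rw [Matrix.transpose_mul, Matrix.transpose_transpose, ← hE'', hC, hBdef, hA]
        simp only [toMat_mul, Matrix.mul_assoc]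
      rw [hfin, Matrix.transpose_apply]
      by_cases hjc : j = c
      · subst hjc
        rcases lt_or_gt_of_ne hij with h1 | h1
        · rw [hE2' _ _ (not_lt.mpr h1.le), Matrix.transpose_apply, hC0 i _ hij (Or.inl h1)]
        · exact hE3' i h1
      · rw [hE1' j (hCc j hjc), Matrix.transpose_apply]
        by_cases hic : i = c
        · subst hic; exact hCc j hjc
        · refine hC0 i j hij ?_
          rcases h with h | h
          · exact Or.inl (lt_of_le_of_ne (Nat.lt_succ_iff.mp h) hic)
          · exact Or.inr (lt_of_le_of_ne (Nat.lt_succ_iff.mp h) hjc)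
  obtain ⟨P, Q, h⟩ := key r le_rfl
  refine ⟨P, Q, fun i => (toMat P * M * toMat Q) i i, ?_⟩
  ext i j : 2
  by_cases hij : i = j
  · subst hij; rw [Matrix.diagonal_apply_eq]
  · rw [h i j hij (Or.inl i.2), Matrix.diagonal_apply_ne _ hij]

/-- Invariant factors: every invertible matrix over `𝓕` is equivalent over `R` to a matrix
`diag(t^{μ₁}, …, t^{μ_r})` with `μ₁ ≥ ⋯ ≥ μ_r`. -/
theorem exists_diagPow {M : Mat r K} (hM : IsUnit M) :
    ∃ (μ : Fin r → ℝ) (P Q : GLR r K), Antitone μ ∧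
      diagPow K μ = toMat P * M * toMat Q⁻¹ := by
  obtain ⟨P, Q, d, hd⟩ := exists_diagonal M
  have hd0 : ∀ i, d i ≠ 0 := by
    have h1 : (Matrix.diagonal d).det ≠ 0 := by
      rw [← hd]
      exact ((Matrix.isUnit_iff_isUnit_det _).mp
        (((isUnit_toMat P).mul hM).mul (isUnit_toMat Q))).ne_zero
    rw [Matrix.det_diagonal] at h1
    exact fun i => Finset.prod_ne_zero_iff.mp h1 i (Finset.mem_univ i)
  let ν : Fin r → ℝ := fun i => (d i : HahnSeries ℝ K).order
  have hν : ∀ i, ((ν i : ℝ) : WithTop ℝ) = ord (d i) := fun i => order_eq_of_ord (hd0 i)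
  -- Each `d i` is a unit of `R` times `t^(ν i)`; `V` removes these units, and a permutation then
  -- sorts the exponents decreasingly.
  obtain ⟨V, hV⟩ : ∃ V : GLR r K,
      toMat V = Matrix.diagonal fun i => tpow K (ν i) * (d i)⁻¹ := by
    refine exists_toMat_eq (fun i j => ?_) ?_
    · by_cases hij : i = j
      · subst hij
        rw [Matrix.diagonal_apply_eq]
        exact ord_div_nonneg (hd0 i) (by rw [ord_tpow, hν])
      · rw [Matrix.diagonal_apply_ne _ hij, ord_zero]; exact le_top
    · rw [Matrix.det_diagonal, ord_prod]
      refine Finset.sum_eq_zero fun i _ => ?_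
      rw [ord_mul, ord_tpow, hν, add_comm, ord_inv_add (hd0 i)]
  let σ := Tuple.sort fun i => -ν i
  obtain ⟨S, hS⟩ := exists_permute_columns (K := K) σ
  obtain ⟨S', hS'⟩ := exists_toMat_eq_transpose S
  refine ⟨ν ∘ σ, S' * V * P, (Q * S)⁻¹, ?_, ?_⟩
  · intro i j hij
    have := Tuple.monotone_sort (fun i => -ν i) hij
    simpa using this
  · have h1 : toMat (S' * V * P) * M * toMat ((Q * S)⁻¹)⁻¹ =
        toMat S' * (toMat V * Matrix.diagonal d) * toMat S := by
      rw [inv_inv, ← hd]; simp only [toMat_mul, Matrix.mul_assoc]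
    have h2 : toMat V * Matrix.diagonal d = diagPow K ν := by
      rw [hV, Matrix.diagonal_mul_diagonal]
      simp only [inv_mul_cancel_right₀ (hd0 _)]; rfl
    rw [h1, h2, hS, hS', ← transpose_diagPow ν, ← Matrix.transpose_mul, hS]
    ext i j : 2
    simp only [Matrix.submatrix_apply, Matrix.transpose_apply, id, diagPow]
    by_cases hij : i = j
    · subst hij; simp
    · rw [Matrix.diagonal_apply_ne _ hij, Matrix.diagonal_apply_ne]
      exact fun h => hij (σ.injective h).symm

end elimination

/-! ### Existence of `μ`-generic matrices -/

section existence

variable {K : Type*} [Field K] {r : ℕ}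

theorem IsUpper.mul {A B : Mat r K} (hA : IsUpper A) (hB : IsUpper B) : IsUpper (A * B) := by
  intro i j hij
  rw [Matrix.mul_apply]
  refine Finset.sum_eq_zero fun l _ => ?_
  rcases lt_or_ge l i with h | h
  · rw [hA i l h, zero_mul]
  · rw [hB l j (hij.trans_le h), mul_zero]

theorem exists_generic_upper_left [Infinite K] (Y₁ Y₂ : Mat r K) :
    ∃ X : GLR r K, IsUpper (toMat X) ∧ ∀ Y : Mat r K, (Y = Y₁ ∨ Y = Y₂) →
      ∀ (k : ℕ) (I J : Fin k ↪o Fin r),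
        (∀ H : Fin k ↪o Fin r, (∀ a, I a ≤ H a) →
          funMinorOrd (toMat X * Y) I J ≤ funMinorOrd Y H J) ∧
        ∀ c : WithTop ℝ, (∀ H : Fin k ↪o Fin r, (∀ a, I a ≤ H a) → c ≤ funMinorOrd Y H J) →
          c ≤ funMinorOrd (toMat X * Y) I J := by
  obtain ⟨X, hX, h⟩ := exists_generic_lower Y₁.transpose Y₂.transpose
  obtain ⟨X', hX'⟩ := exists_toMat_eq_transpose X
  refine ⟨X', fun i j hij => by rw [hX']; exact hX j i hij, fun Y hY k I J => ?_⟩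
  have := h Y.transpose (by rcases hY with rfl | rfl <;> simp) k J I
  simp only [← funMinorOrd_transpose (Y.transpose * toMat X), Matrix.transpose_mul,
    Matrix.transpose_transpose, ← hX', funMinorOrd_transpose Y] at this
  exact this

theorem exists_generic_lower_left [Infinite K] (Y₁ Y₂ : Mat r K) :
    ∃ X : GLR r K, IsLower (toMat X) ∧ ∀ Y : Mat r K, (Y = Y₁ ∨ Y = Y₂) →
      ∀ (k : ℕ) (I J : Fin k ↪o Fin r),
        (∀ H : Fin k ↪o Fin r, (∀ a, H a ≤ I a) →
          funMinorOrd (toMat X * Y) I J ≤ funMinorOrd Y H J) ∧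
        ∀ c : WithTop ℝ, (∀ H : Fin k ↪o Fin r, (∀ a, H a ≤ I a) → c ≤ funMinorOrd Y H J) →
          c ≤ funMinorOrd (toMat X * Y) I J := by
  obtain ⟨X, hX, h⟩ := exists_generic_upper Y₁.transpose Y₂.transpose
  obtain ⟨X', hX'⟩ := exists_toMat_eq_transpose X
  refine ⟨X', fun i j hij => by rw [hX']; exact hX j i hij, fun Y hY k I J => ?_⟩
  have := h Y.transpose (by rcases hY with rfl | rfl <;> simp) k J I
  simp only [← funMinorOrd_transpose (Y.transpose * toMat X), Matrix.transpose_mul,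
    Matrix.transpose_transpose, ← hX', funMinorOrd_transpose Y] at this
  exact this

/-- Conjugation multiplies the entry `(i, j)` by `t^(ν i - ν j)`, a non-negative power wherever the
entry is non-zero, and preserves the determinant. -/
theorem exists_conj_diagPow (ν : Fin r → ℝ) (A : GLR r K)
    (h : ∀ i j, toMat A i j ≠ 0 → ν j ≤ ν i) :
    ∃ P : GLR r K, toMat P = diagPow K ν * toMat A * (diagPow K ν)⁻¹ := by
  refine exists_toMat_eq (fun i j => ?_) ?_
  · rw [diagPow_inv, mul_diagPow_apply, diagPow_mul_apply]
    by_cases h0 : toMat A i j = 0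
    · simp [h0, ord_zero]
    · rw [mul_right_comm, tpow_mul_tpow, ord_mul, ord_tpow]
      refine add_nonneg ?_ (ord_toMat_nonneg A i j)
      have := h i j h0
      exact_mod_cast (by linarith : (0 : ℝ) ≤ ν i + -ν j)
  · rw [Matrix.det_mul_right_comm, diagPow_mul_inv, one_mul, ord_det_toMat]

theorem ord_det_trailingBlock (A : Mat r K) (c : Fin r) :
    ∃ J : Fin (r - c) ↪o Fin r, ord (trailingBlock A c).det = funMinorOrd A J J := by
  let J : Fin (r - c) ↪o Fin r := OrderEmbedding.ofStrictMono
    (fun a => ⟨c + a, by omega⟩) fun a b hab => by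
      simp only [Fin.mk_lt_mk]
      have : (a : ℕ) < b := hab
      omega
  let e : Fin (r - c) ≃ {i : Fin r // c ≤ i} :=
    { toFun := fun a => ⟨J a, show (c : ℕ) ≤ c + a by omega⟩
      invFun := fun i => ⟨(i : Fin r) - c, by have := i.1.2; have : (c : ℕ) ≤ (i : Fin r) := i.2; omega⟩
      left_inv := fun a => by
        apply Fin.ext
        change (c : ℕ) + a - c = a
        omega
      right_inv := fun i => by
        apply Subtype.ext; apply Fin.ext
        have : (c : ℕ) ≤ (i : Fin r) := i.2
        change (c : ℕ) + ((i : Fin r) - c) = (i : Fin r)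
        omega }
  refine ⟨J, ?_⟩
  rw [← Matrix.det_submatrix_equiv_self e]; rfl

theorem coe_add_le_coe_add {a b : ℝ} {x y : WithTop ℝ}
    (h : ((a - b : ℝ) : WithTop ℝ) + x ≤ y) : (a : WithTop ℝ) + x ≤ (b : WithTop ℝ) + y := by
  induction y using WithTop.recTopCoe with
  | top => simp
  | coe y =>
    induction x using WithTop.recTopCoe with
    | top => simp at h
    | coe x => norm_cast at h ⊢; linarith

/-- With `Q = L U` and `L = D⁻¹ C D`, monotonicity of `μ` makes both `L` and `D U D⁻¹` integral, and
`D Q D⁻¹ = C (D U D⁻¹)` gives admissibility. Genericity of `U` and `C` yields the formula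
`‖(QN)_{IJ}‖ = min_{B ≤ I} (|μ_B| + ‖(UN)_{BJ}‖) - |μ_I|`, where `‖(UN)_{BJ}‖ = min_{A ≥ B}
‖N_{AJ}‖`. Both row inequalities follow from it. -/
theorem exists_isMuGeneric [Infinite K] {μ : Fin r → ℝ} (hμ : Antitone μ) (N : Mat r K) :
    ∃ Nstar, IsMuGeneric μ N Nstar := by
  obtain ⟨U, hU, hUg⟩ := exists_generic_upper_left N 1
  set D := diagPow K μ with hD
  obtain ⟨C, hC, hCg⟩ := exists_generic_lower_left (D * (toMat U * N)) (D * toMat U)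
  obtain ⟨L, hL⟩ := exists_conj_diagPow (fun i => -μ i) C fun i j hij => by
    have : j ≤ i := not_lt.mp fun h => hij (hC i j h)
    simpa using hμ this
  obtain ⟨P, hP⟩ := exists_conj_diagPow μ U fun i j hij =>
    hμ (not_lt.mp fun h => hij (hU i j h))
  rw [diagPow_inv] at hL
  simp only [neg_neg] at hL
  change toMat L = _ * toMat C * D at hL
  rw [← hD] at hP
  have hLl : IsLower (toMat L) := fun i j hij => by
    rw [hL, hD, mul_diagPow_apply, diagPow_mul_apply, hC i j hij, mul_zero, zero_mul]
  have hQ : toMat (L * U) = diagPow K (fun i => -μ i) * (toMat C * (D * toMat U)) := by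
    rw [toMat_mul, hL]; simp only [Matrix.mul_assoc]
  have hQN : toMat (L * U) * N =
      diagPow K (fun i => -μ i) * (toMat C * (D * (toMat U * N))) := by
    rw [hQ]; simp only [Matrix.mul_assoc]
  -- `C` and `U` were also chosen generic for `D U` and for `1`, so a principal minor of `Q` has
  -- order at most that of the same minor of the identity, namely `0`. This supplies the
  -- upper-times-lower factorization.
  have htrail : ∀ c, ord (trailingBlock (toMat (L * U)) c).det = 0 := by
    intro c
    refine le_antisymm ?_ (ord_det_nonneg fun i j => ord_toMat_nonneg _ _ _)
    obtain ⟨J, hJ⟩ := ord_det_trailingBlock (toMat (L * U)) c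
    rw [hJ, hQ, funMinorOrd_diagPow_mul]
    have h1 := (hCg _ (Or.inr rfl) _ J J).1 J fun _ => le_rfl
    have h2 := (hUg _ (Or.inr rfl) _ J J).1 J fun _ => le_rfl
    rw [hD, funMinorOrd_diagPow_mul, ← hD] at h1
    have h3 : funMinorOrd (1 : Mat _ K) J J = 0 := by
      rw [funMinorOrd, Matrix.submatrix_one _ J.injective, Matrix.det_one, ord_one]
    rw [mul_one, h3] at h2
    refine (add_le_add_right (h1.trans (add_le_add_right h2 _)) _).trans (le_of_eq ?_)
    rw [add_zero, ← WithTop.coe_add, Finset.sum_neg_distrib, neg_add_cancel]; rfl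
  obtain ⟨T₁, hT₁⟩ := exists_mul_isUpper (toMat (L * U) * N)
  obtain ⟨X, hX, hXg⟩ := exists_generic_upper (toMat (L * U) * N * toMat T₁) 1
  refine ⟨toMat (L * U) * N * toMat T₁ * toMat X, hT₁.mul hX, L * U, (T₁ * X)⁻¹, ?_, ⟨C * P, ?_⟩,
    exists_upper_mul_lower _ htrail, ⟨L, U, hLl, hU, rfl⟩, ?_, ?_⟩
  · rw [inv_inv, toMat_mul T₁]; simp only [Matrix.mul_assoc]
  · rw [toMat_mul, hP, hQ, ← hD, ← Matrix.mul_assoc D, hD, diagPow_mul_diagPow]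
    simp only [add_neg_cancel, diagPow_zero, Matrix.one_mul, Matrix.mul_assoc]
  · intro k I H J hIH
    have hg := hCg _ (Or.inl rfl) k
    simp only [minorOrd_eq, hQN, funMinorOrd_diagPow_mul (fun i => -μ i)]
    set g : (Fin k ↪o Fin r) → WithTop ℝ :=
      fun I => funMinorOrd (toMat C * (D * (toMat U * N))) I J with hgdef
    have hV : ∀ B : Fin k ↪o Fin r, funMinorOrd (D * (toMat U * N)) B J =
        ((∑ a, μ (B a) : ℝ) : WithTop ℝ) + funMinorOrd (toMat U * N) B J := fun B =>
      funMinorOrd_diagPow_mul μ _ _ _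
    constructor
    · apply coe_add_le_coe_add
      refine (hg H J).2 _ fun B hB => ?_
      -- A term `B ≤ H` of the minimum for `H` is compared with the term `B' = min(B, I)` of the
      -- minimum for `I`: its `UN` minor is no larger, and `|μ_{B'}| - |μ_I| ≤ |μ_B| - |μ_H|` entry
      -- by entry.
      let B' : Fin k ↪o Fin r := OrderEmbedding.ofStrictMono (fun a => min (B a) (I a))
        fun a b hab => min_lt_min (B.strictMono hab) (I.strictMono hab)
      have hB'B : ∀ a, B' a ≤ B a := fun a => min_le_left _ _
      have hB'I : ∀ a, B' a ≤ I a := fun a => min_le_right _ _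
      have h1 := (hg I J).1 B' hB'I
      have h2 : funMinorOrd (toMat U * N) B' J ≤ funMinorOrd (toMat U * N) B J :=
        (hUg _ (Or.inl rfl) k B J).2 _ fun A hA =>
          (hUg _ (Or.inl rfl) k B' J).1 A fun a => (hB'B a).trans (hA a)
      have h3 : ∑ a, μ (H a) - ∑ a, μ (I a) + ∑ a, μ (B' a) ≤ ∑ a, μ (B a) := by
        rw [← Finset.sum_sub_distrib, ← Finset.sum_add_distrib]
        refine Finset.sum_le_sum fun a _ => ?_
        rcases le_total (B a) (I a) with h | h
        · rw [show B' a = B a from min_eq_left h]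
          have := hμ (hIH a); linarith
        · rw [show B' a = I a from min_eq_right h]
          have := hμ (hB a); linarith
      rw [hV] at h1 ⊢
      refine (add_le_add_right (h1.trans (add_le_add_right h2 _)) _).trans ?_
      rw [← add_assoc, ← WithTop.coe_add]
      refine add_le_add_left (WithTop.coe_le_coe.mpr ?_) _
      simp only [Finset.sum_neg_distrib]
      linarith
    -- The minimum for `H` runs over more index sets than the one for `I`.
    · have h1 : g H ≤ g I := (hg I J).2 _ fun B hB => (hg H J).1 B fun a => (hB a).trans (hIH a)
      rw [add_right_comm, ← WithTop.coe_add]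
      refine (add_le_add_right h1 _).trans (le_of_eq ?_)
      congr 2
      simp only [Finset.sum_neg_distrib]
      ring
  · intro k I H J _ hHJ
    have h := hXg _ (Or.inl rfl) k I
    exact (h H).2 _ fun H' hH' => (h J).1 H' fun a => (hH' a).trans (hHJ a)

end existence

/-! ### A three-term Plücker relation -/

section plucker

/-- A three-term incidence relation between the maximal minors of size `m + 1` and `m + 2`. -/
theorem det_three_term {F : Type*} [Field F] {m : ℕ} (a b c : Fin (m + 2) → F)
    (S : Fin m → Fin (m + 2) → F)
    (φ : (Fin (m + 2) → F) → F) (ψ : (Fin (m + 2) → F) → (Fin (m + 2) → F) → F)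
    (hφ : ∀ x, φ x = (Matrix.of fun (i j : Fin (m + 1)) =>
      (Fin.cons x S : Fin (m + 1) → Fin (m + 2) → F) i j.succ).det)
    (hψ : ∀ x y, ψ x y = (Matrix.of
      (Fin.cons x (Fin.cons y S : Fin (m + 1) → Fin (m + 2) → F) :
        Fin (m + 2) → Fin (m + 2) → F)).det) :
    φ a * ψ b c - φ b * ψ a c + φ c * ψ a b = 0 := by
  let R : Fin (m + 3) → Fin (m + 2) → F :=
    Fin.cons a (Fin.cons b (Fin.cons c S : Fin (m + 1) → Fin (m + 2) → F) :
      Fin (m + 2) → Fin (m + 2) → F)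
  -- Since `φ` is linear and ignores coordinate `0`, the added first column is a combination of the
  -- later ones. Hence `det B = 0`, and expansion along that column leaves three terms because `φ`
  -- vanishes on the rows of `S`.
  let B : Matrix (Fin (m + 3)) (Fin (m + 3)) F :=
    Matrix.of fun i => (Fin.cons (φ (R i)) (R i) : Fin (m + 3) → F)
  let w : Fin (m + 1) → F := fun j => (-1) ^ (j : ℕ) *
    (Matrix.of fun (i l : Fin m) => S i (j.succAbove l).succ).det
  have hw : ∀ x, φ x = ∑ j, x j.succ * w j := by
    intro x
    rw [hφ, Matrix.det_succ_row_zero]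
    refine Finset.sum_congr rfl fun j _ => ?_
    simp only [Matrix.of_apply, Fin.cons_zero, w]
    rw [mul_comm ((-1 : F) ^ (j : ℕ)), mul_assoc]
    rfl
  have hB : B.det = 0 := by
    rw [← Matrix.exists_mulVec_eq_zero_iff]
    refine ⟨Fin.cons (-1) (Fin.cons 0 w : Fin (m + 2) → F), fun h => ?_, ?_⟩
    · have := congrFun h 0
      simp at this
    · funext i
      simp only [Matrix.mulVec, dotProduct, Fin.sum_univ_succ (n := m + 2),
        Fin.sum_univ_succ (n := m + 1), B, Matrix.of_apply, Fin.cons_zero, Fin.cons_succ,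
        Pi.zero_apply]
      rw [hw]; ring
  have hS : ∀ s, φ (S s) = 0 := by
    intro s
    rw [hφ]
    refine Matrix.det_zero_of_row_eq (i := 0) (j := s.succ) (Fin.succ_ne_zero s).symm ?_
    funext j
    simp
  have h0 : (B.submatrix (Fin.succAbove 0) Fin.succ).det = ψ b c := by
    rw [hψ]; congr 1
  have h1 : (B.submatrix (Fin.succAbove 1) Fin.succ).det = ψ a c := by
    rw [hψ]; congr 1
    ext i j
    refine Fin.cases ?_ (fun i => ?_) i
    · simp [B, R]
    · have : Fin.succAbove (1 : Fin (m + 3)) i.succ = i.succ.succ := by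
        rw [← Fin.succ_zero_eq_one, Fin.succ_succAbove_succ, Fin.succAbove_zero]
      simp [B, R, this]
  have h2 : (B.submatrix (Fin.succAbove 2) Fin.succ).det = ψ a b := by
    rw [hψ]; congr 1
    ext i j
    refine Fin.cases ?_ (fun i => Fin.cases ?_ (fun i => ?_) i) i
    · have : Fin.succAbove (2 : Fin (m + 3)) 0 = 0 :=
        Fin.succAbove_ne_zero_zero fun h => by
          rw [show (2 : Fin (m + 3)) = Fin.succ (Fin.succ 0) from rfl] at h
          exact Fin.succ_ne_zero _ h
      simp [B, R, this]
    · have : Fin.succAbove (2 : Fin (m + 3)) (Fin.succ 0) = Fin.succ 0 := by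
        rw [show (2 : Fin (m + 3)) = Fin.succ (Fin.succ 0) from rfl, Fin.succ_succAbove_succ,
          Fin.succ_succAbove_zero]
      simp only [Matrix.submatrix_apply, this]
      simp [B, R]
    · have : Fin.succAbove (2 : Fin (m + 3)) i.succ.succ = i.succ.succ.succ := by
        rw [show (2 : Fin (m + 3)) = Fin.succ (Fin.succ 0) from rfl, Fin.succ_succAbove_succ,
          Fin.succ_succAbove_succ, Fin.succAbove_zero]
      simp [B, R, this]
  rw [Matrix.det_succ_column_zero, Fin.sum_univ_succ, Fin.sum_univ_succ, Fin.sum_univ_succ,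
    Finset.sum_eq_zero] at hB
  · have e1 : B 0 0 = φ a := rfl
    have e2 : B (Fin.succ 0) 0 = φ b := rfl
    have e3 : B (Fin.succ (Fin.succ 0)) 0 = φ c := rfl
    rw [e1, e2, e3, h0] at hB
    change _ + ((-1) ^ (1 : ℕ) * φ b * (B.submatrix (Fin.succAbove 1) Fin.succ).det +
      ((-1) ^ (2 : ℕ) * φ c * (B.submatrix (Fin.succAbove 2) Fin.succ).det + 0)) = 0 at hB
    rw [h1, h2] at hB
    simp only [Fin.val_zero, pow_zero] at hB
    linear_combination hB
  · intro i _
    have : B i.succ.succ.succ 0 = φ (S i) := rfl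
    rw [this, hS, mul_zero, zero_mul]

end plucker

/-! ### Right-most minors of a `μ`-generic matrix -/

section rightMinors

variable {K : Type*} [Field K] {r : ℕ}

theorem funMinorOrd_exists_ne_top {A : Mat r K} (hA : IsUnit A) {k : ℕ} (I : Fin k ↪o Fin r) :
    ∃ J : Fin k ↪o Fin r, funMinorOrd A I J ≠ ⊤ := by
  by_contra hcon
  push Not at hcon
  have h1 : ((A * A⁻¹).submatrix I I).det = 0 := by
    rw [det_submatrix_mul]
    refine Finset.sum_eq_zero fun p _ => ?_
    have : funMinorOrd A I p = ⊤ :=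
      top_le_iff.mp (le_funMinorOrd_of_sorted_right (fun J => (hcon J).ge) p)
    rw [funMinorOrd, ord_eq_top_iff] at this
    rw [this, mul_zero]
  rw [Matrix.mul_nonsing_inv _ ((Matrix.isUnit_iff_isUnit_det _).mp hA),
    Matrix.submatrix_one _ I.injective, Matrix.det_one] at h1
  exact one_ne_zero h1

theorem le_lastIdx {k : ℕ} (h : k ≤ r) (J : Fin k ↪o Fin r) (a : Fin k) : J a ≤ lastIdx h a := by
  have key : ∀ n : ℕ, ∀ a : Fin k, (a : ℕ) + n + 1 = k → (J a : ℕ) + n < r := by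
    intro n
    induction n with
    | zero => intro a _; simp
    | succ n ih =>
      intro a ha
      have h1 := ih ⟨a + 1, by omega⟩ (by simp only; omega)
      have h2 : J a < J ⟨a + 1, by omega⟩ := J.strictMono (by simp [Fin.lt_def])
      have h3 : (J a : ℕ) < (J ⟨a + 1, by omega⟩ : Fin r) := h2
      omega
  have h1 := key (k - a - 1) a (by omega)
  change (J a : ℕ) ≤ r - k + a
  omega

theorem castLE_le {k : ℕ} (h : k ≤ r) (J : Fin k ↪o Fin r) (a : Fin k) :
    Fin.castLEOrderEmb h a ≤ J a := by
  have key : ∀ n : ℕ, ∀ hn : n < k, n ≤ (J ⟨n, hn⟩ : ℕ) := by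
    intro n
    induction n with
    | zero => intro _; omega
    | succ n ih =>
      intro hn
      have h1 := ih (by omega)
      have h2 : J ⟨n, by omega⟩ < J ⟨n + 1, hn⟩ := J.strictMono (by simp [Fin.lt_def])
      have h3 : (J ⟨n, by omega⟩ : ℕ) < (J ⟨n + 1, hn⟩ : Fin r) := h2
      omega
  exact key a a.2

theorem lastIdx_succ {k : ℕ} (h : k + 1 ≤ r) (a : Fin k) :
    lastIdx h a.succ = lastIdx (Nat.le_of_succ_le h) a := by
  apply Fin.ext
  change r - (k + 1) + ((a : ℕ) + 1) = r - k + a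
  omega

/-- `rightOrd` is real-valued and takes the value `0` on a vanishing minor; `hne` excludes this
case. Rows may be listed in any order, which allows row sets to be built with `Fin.cons`. -/
theorem coe_rightOrd {A : Mat r K} {k : ℕ} (h : k ≤ r) {p : Fin k → Fin r}
    (hp : Function.Injective p) {I : Finset (Fin r)} (hI : ∀ x, x ∈ I ↔ x ∈ Set.range p)
    (hne : ∀ H : Fin k ↪o Fin r, funMinorOrd A H (lastIdx h) ≠ ⊤) :
    (rightOrd A I : WithTop ℝ) = funMinorOrd A p (lastIdx h) := by
  obtain ⟨H, σ, rfl⟩ := exists_sorted hp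
  rw [funMinorOrd_perm_left]
  have hI' : ∀ x, x ∈ I ↔ x ∈ Set.range H := fun x => by
    rw [hI, Set.range_comp, σ.range_eq_univ, Set.image_univ]
  have hk : I.card = k := by
    have : I = Finset.univ.map H.toEmbedding := by
      ext x; rw [hI']; simp
    rw [this, Finset.card_map, Finset.card_univ, Fintype.card_fin]
  subst hk
  have hH : (H : Fin I.card → Fin r) = I.orderEmbOfFin rfl :=
    Finset.orderEmbOfFin_unique rfl (fun a => (hI' _).mpr ⟨a, rfl⟩) H.strictMono
  have h1 := hne H
  rw [funMinorOrd, Ne, ord_eq_top_iff] at h1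
  rw [funMinorOrd, ← order_eq_of_ord h1, rightOrd, hH]

/-- The right-most minors of a `μ`-generic matrix: they have the least order among the minors with
the same rows, and they satisfy the two row inequalities. -/
theorem IsMuGeneric.right_minors {μ : Fin r → ℝ} {N Nstar : Mat r K} (h : IsMuGeneric μ N Nstar)
    {k : ℕ} (hk : k ≤ r) :
    (∀ I J : Fin k ↪o Fin r, funMinorOrd Nstar I (lastIdx hk) ≤ funMinorOrd Nstar I J) ∧
    ∀ I H : Fin k ↪o Fin r, (∀ a, I a ≤ H a) →
      funMinorOrd Nstar I (lastIdx hk) ≤ funMinorOrd Nstar H (lastIdx hk) ∧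
      funMinorOrd Nstar H (lastIdx hk) ≤ funMinorOrd Nstar I (lastIdx hk) +
        ((∑ a, μ (I a) - ∑ a, μ (H a) : ℝ) : WithTop ℝ) := by
  obtain ⟨hU, Q, T, hN, -, -, -, hrow, hcol⟩ := h
  have hA : ∀ I J : Fin k ↪o Fin r,
      funMinorOrd Nstar I (lastIdx hk) ≤ funMinorOrd Nstar I J := by
    intro I J
    by_cases hIJ : ∀ a, I a ≤ J a
    · exact hcol k I J (lastIdx hk) hIJ (le_lastIdx hk J)
    · rw [hU.funMinorOrd_eq_top hIJ]; exact le_top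
  -- `hB` and `hC` show that the right-most minor of `N^*` in rows `I` has the least order among all
  -- minors of `Q N` in rows `I`, as `T` and `T⁻¹` are integral. So the row inequalities for `Q N`
  -- pass to `N^*`.
  have hB : ∀ I J : Fin k ↪o Fin r,
      funMinorOrd Nstar I (lastIdx hk) ≤ funMinorOrd (toMat Q * N) I J := by
    intro I J
    have h1 : toMat Q * N = Nstar * toMat T := by
      rw [hN, Matrix.mul_assoc _ (toMat T⁻¹), toMat_inv_mul, Matrix.mul_one]
    rw [h1]
    exact le_funMinorOrd_mul_right (ord_toMat_nonneg T) (le_funMinorOrd_of_sorted_right (hA I))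
  have hC : ∀ (I : Fin k ↪o Fin r) (c : WithTop ℝ),
      (∀ J : Fin k ↪o Fin r, c ≤ funMinorOrd (toMat Q * N) I J) →
      c ≤ funMinorOrd Nstar I (lastIdx hk) := by
    intro I c hc
    rw [hN]
    exact le_funMinorOrd_mul_right (ord_toMat_nonneg _) (le_funMinorOrd_of_sorted_right hc)
  refine ⟨hA, fun I H hIH => ⟨hC H _ fun J => (hB I J).trans (hrow k I H J hIH).1, ?_⟩⟩
  have h1 : funMinorOrd Nstar H (lastIdx hk) +
      ((∑ a, μ (H a) - ∑ a, μ (I a) : ℝ) : WithTop ℝ) ≤ funMinorOrd Nstar I (lastIdx hk) := by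
    refine hC I _ fun J => ?_
    refine (add_le_add_left ((hB H J).trans (hrow k I H J hIH).2) _).trans (le_of_eq ?_)
    rw [add_assoc, ← WithTop.coe_add, sub_add_sub_cancel, sub_self, WithTop.coe_zero, add_zero]
    rfl
  refine le_trans (le_of_eq ?_) (add_le_add_left h1 _)
  rw [add_assoc, ← WithTop.coe_add, sub_add_sub_cancel, sub_self, WithTop.coe_zero, add_zero]

theorem IsMuGeneric.right_minors_mono {μ : Fin r → ℝ} {N Nstar : Mat r K}
    (h : IsMuGeneric μ N Nstar) {k : ℕ} (hk : k ≤ r) {p q : Fin k → Fin r}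
    (hp : Function.Injective p) (hq : Function.Injective q) (hpq : ∀ a, p a ≤ q a) :
    funMinorOrd Nstar p (lastIdx hk) ≤ funMinorOrd Nstar q (lastIdx hk) := by
  obtain ⟨I, σ, rfl⟩ := exists_sorted hp
  obtain ⟨H, τ, rfl⟩ := exists_sorted hq
  rw [funMinorOrd_perm_left, funMinorOrd_perm_left]
  refine ((h.right_minors hk).2 I H (le_of_comp_perm_le (σ := τ⁻¹.trans σ) fun a => ?_)).1
  simpa using hpq (τ⁻¹ a)

theorem IsMuGeneric.right_minors_ne_top {μ : Fin r → ℝ} {N Nstar : Mat r K}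
    (h : IsMuGeneric μ N Nstar) (hN : IsUnit Nstar) {k : ℕ} (hk : k ≤ r) (I : Fin k ↪o Fin r) :
    funMinorOrd Nstar I (lastIdx hk) ≠ ⊤ := by
  obtain ⟨J, hJ⟩ := funMinorOrd_exists_ne_top hN I
  exact ne_top_of_le_ne_top hJ ((h.right_minors hk).1 I J)

/-- In the Plücker relation `φ(c) ψ(a,b) = φ(b) ψ(a,c) - φ(a) ψ(b,c)`, replacing `b` by the smaller
row `a` in `φ(b)`, respectively in `ψ(b,c)`, does not raise the order. Both terms on the right
therefore have order at least that of `φ(a) ψ(a,c)`. -/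
theorem IsMuGeneric.three_term_le {μ : Fin r → ℝ} {N Nstar : Mat r K}
    (h : IsMuGeneric μ N Nstar) {m : ℕ} (hm : m + 2 ≤ r) {S : Fin m → Fin r} {a b c : Fin r}
    (hS : Function.Injective S) (hab : a < b) (hbc : b < c)
    (ha : a ∉ Set.range S) (hb : b ∉ Set.range S) (hc : c ∉ Set.range S) :
    funMinorOrd Nstar (Fin.cons a S : Fin (m + 1) → Fin r) (lastIdx (Nat.le_of_succ_le hm)) +
      funMinorOrd Nstar (Fin.cons a (Fin.cons c S : Fin (m + 1) → Fin r)) (lastIdx hm) ≤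
    funMinorOrd Nstar (Fin.cons c S : Fin (m + 1) → Fin r) (lastIdx (Nat.le_of_succ_le hm)) +
      funMinorOrd Nstar (Fin.cons a (Fin.cons b S : Fin (m + 1) → Fin r)) (lastIdx hm) := by
  have inj1 : ∀ x, x ∉ Set.range S → Function.Injective (Fin.cons x S : Fin (m + 1) → Fin r) :=
    fun x hx => Fin.cons_injective_iff.mpr ⟨hx, hS⟩
  have inj2 : ∀ x y, x ≠ y → x ∉ Set.range S → y ∉ Set.range S →
      Function.Injective (Fin.cons x (Fin.cons y S : Fin (m + 1) → Fin r) : Fin (m + 2) → Fin r) :=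
    fun x y hxy hx hy => Fin.cons_injective_iff.mpr ⟨by
      rw [Fin.range_cons]; simp only [Set.mem_insert_iff, not_or]; exact ⟨hxy, hx⟩, inj1 y hy⟩
  have hle1 := h.right_minors_mono (Nat.le_of_succ_le hm) (inj1 a ha) (inj1 b hb)
    (Fin.cases hab.le fun _ => le_rfl)
  have hle2 := h.right_minors_mono hm (inj2 a c (hab.trans hbc).ne ha hc) (inj2 b c hbc.ne hb hc)
    (Fin.cases hab.le fun _ => le_rfl)
  let row : Fin r → Fin (m + 2) → SeriesField K := fun x j => Nstar x (lastIdx hm j)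
  let φ : (Fin (m + 2) → SeriesField K) → SeriesField K := fun x =>
    (Matrix.of fun (i j : Fin (m + 1)) =>
      (Fin.cons x (row ∘ S) : Fin (m + 1) → Fin (m + 2) → SeriesField K) i j.succ).det
  let ψ : (Fin (m + 2) → SeriesField K) → (Fin (m + 2) → SeriesField K) → SeriesField K :=
    fun x y => (Matrix.of
      (Fin.cons x (Fin.cons y (row ∘ S) : Fin (m + 1) → Fin (m + 2) → SeriesField K) :
        Fin (m + 2) → Fin (m + 2) → SeriesField K)).det
  have key := det_three_term (row a) (row b) (row c) (row ∘ S) φ ψ (fun _ => rfl) fun _ _ => rfl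
  have hφ : ∀ x, ord (φ (row x)) =
      funMinorOrd Nstar (Fin.cons x S : Fin (m + 1) → Fin r) (lastIdx (Nat.le_of_succ_le hm)) := by
    intro x
    rw [funMinorOrd]
    refine congrArg (fun A => ord (Matrix.det A)) (Matrix.ext fun i j => ?_)
    refine Fin.cases ?_ (fun i => ?_) i <;>
      simp only [Matrix.of_apply, Matrix.submatrix_apply, Fin.cons_zero, Fin.cons_succ,
        Function.comp_apply, row, lastIdx_succ]
  have hψ : ∀ x y, ord (ψ (row x) (row y)) =
      funMinorOrd Nstar (Fin.cons x (Fin.cons y S : Fin (m + 1) → Fin r)) (lastIdx hm) := by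
    intro x y
    rw [funMinorOrd]
    refine congrArg (fun A => ord (Matrix.det A)) (Matrix.ext fun i j => ?_)
    refine Fin.cases ?_ (fun i => Fin.cases ?_ (fun i => ?_) i) i <;>
      simp only [Matrix.of_apply, Matrix.submatrix_apply, Fin.cons_zero, Fin.cons_succ,
        Function.comp_apply, row]
  have h1 : φ (row c) * ψ (row a) (row b) =
      φ (row b) * ψ (row a) (row c) + -(φ (row a) * ψ (row b) (row c)) := by
    linear_combination key
  simp only [← hφ, ← hψ] at hle1 hle2 ⊢
  rw [← ord_mul (φ (row c)), h1]
  refine le_ord_add ?_ ?_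
  · rw [ord_mul]; exact add_le_add_left hle1 _
  · rw [ord_neg, ord_mul]; exact add_le_add_right hle2 _

end rightMinors

/-! ### Bounds valid on a whole orbit -/

section bounds

variable {K : Type*} [Field K] {r : ℕ}

theorem isUnit_diagPow (μ : Fin r → ℝ) : IsUnit (diagPow K μ) :=
  ⟨⟨_, _, diagPow_mul_inv μ, diagPow_inv_mul μ⟩, rfl⟩

/-- The orders of the minors of all the matrices equivalent to `N` have a common lower bound, and
the least of them a common upper bound. -/
theorem exists_minor_bounds {N : Mat r K} (hN : IsUnit N) :
    ∃ C : ℝ, ∀ (G H : GLR r K) (k : ℕ), k ≤ r →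
      (∀ p q : Fin k → Fin r, ((-C : ℝ) : WithTop ℝ) ≤ funMinorOrd (toMat G * N * toMat H) p q) ∧
      ∃ I J : Fin k ↪o Fin r, funMinorOrd (toMat G * N * toMat H) I J ≤ (C : WithTop ℝ) := by
  have hlow : ∀ z : (Σ k : Fin (r + 1), (Fin k → Fin r) × (Fin k → Fin r)),
      ∃ c : ℝ, (c : WithTop ℝ) ≤ funMinorOrd N z.2.1 z.2.2 := by
    intro z
    induction funMinorOrd N z.2.1 z.2.2 using WithTop.recTopCoe with
    | top => exact ⟨0, le_top⟩
    | coe x => exact ⟨x, le_rfl⟩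
  have hup : ∀ k : Fin (r + 1), ∃ c : ℝ, ∃ I J : Fin (k : ℕ) ↪o Fin r,
      funMinorOrd N I J ≤ (c : WithTop ℝ) := by
    intro k
    obtain ⟨J, hJ⟩ := funMinorOrd_exists_ne_top hN (Fin.castLEOrderEmb (Nat.lt_succ_iff.mp k.2))
    obtain ⟨x, hx⟩ := WithTop.ne_top_iff_exists.mp hJ
    exact ⟨x, _, J, hx.ge⟩
  choose c hc using hlow
  choose u hu using hup
  obtain ⟨cl, hcl⟩ := (Set.finite_range c).bddBelow
  obtain ⟨cu, hcu⟩ := (Set.finite_range u).bddAbove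
  refine ⟨max (-cl) cu, fun G H k hk => ⟨fun p q => ?_, ?_⟩⟩
  · refine le_funMinorOrd_mul_right (ord_toMat_nonneg H) fun q =>
      le_funMinorOrd_mul_left (ord_toMat_nonneg G) fun p => ?_
    refine le_trans (WithTop.coe_le_coe.mpr ?_) (hc ⟨⟨k, by omega⟩, p, q⟩)
    have h1 := hcl ⟨⟨⟨k, by omega⟩, p, q⟩, rfl⟩
    have h2 := le_max_left (-cl) cu
    linarith
  · obtain ⟨I₀, J₀, h0⟩ := hu ⟨k, by omega⟩
    have : Nonempty (Fin k ↪o Fin r) := ⟨I₀⟩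
    obtain ⟨⟨I, J⟩, hIJ⟩ := Finite.exists_min
      fun z : (Fin k ↪o Fin r) × (Fin k ↪o Fin r) =>
        funMinorOrd (toMat G * N * toMat H) z.1 z.2
    refine ⟨I, J, ?_⟩
    -- The minors of `N` are `R`-combinations of those of `G N H`, so the least order for `G N H` is
    -- at most any order for `N`.
    have h1 : N = toMat G⁻¹ * (toMat G * N * toMat H) * toMat H⁻¹ := by
      rw [← Matrix.mul_assoc, ← Matrix.mul_assoc, toMat_inv_mul, Matrix.one_mul,
        Matrix.mul_assoc, toMat_mul_inv, Matrix.mul_one]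
    have h2 : funMinorOrd (toMat G * N * toMat H) I J ≤ funMinorOrd N I₀ J₀ := by
      conv_rhs => rw [h1]
      refine le_funMinorOrd_mul_right (ord_toMat_nonneg _) fun q =>
        le_funMinorOrd_mul_left (ord_toMat_nonneg _) fun p => ?_
      refine le_funMinorOrd_of_sorted_right (fun J' => ?_) q
      rw [← funMinorOrd_transpose (toMat G * N * toMat H) _ p]
      refine le_funMinorOrd_of_sorted_right (fun I' => ?_) p
      rw [funMinorOrd_transpose]
      exact hIJ (I', J')
    refine h2.trans (h0.trans (WithTop.coe_le_coe.mpr ?_))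
    exact (hcu ⟨_, rfl⟩).trans (le_max_right _ _)

theorem funMinorOrd_single (A : Mat r K) (i j : Fin r) :
    funMinorOrd A (fun _ : Fin 1 => i) (fun _ => j) = ord (A i j) := by
  rw [funMinorOrd, Matrix.det_unique]; rfl

/-- The differences of the invariant factors are bounded, uniformly in the scaling. -/
theorem exists_invariant_factor_bound {M : Mat r K} (hM : IsUnit M) :
    ∃ B : ℝ, 0 ≤ B ∧ ∀ (β : ℝ) (μ : Fin r → ℝ) (P Q : GLR r K),
      diagPow K μ = toMat P * (scalarPow r K β * M) * toMat Q⁻¹ → ∀ i j, μ i - μ j ≤ B := by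
  obtain ⟨C₁, h₁⟩ := exists_minor_bounds hM
  obtain ⟨C₂, h₂⟩ := exists_minor_bounds
    ((Matrix.isUnit_nonsing_inv_iff (A := M)).mpr hM)
  refine ⟨max (C₁ + C₂) 0, le_max_right _ _, fun β μ P Q h i j => le_trans ?_ (le_max_left _ _)⟩
  have hr : 1 ≤ r := by have := i.2; omega
  have e1 : diagPow K μ = diagPow K (fun _ => β) * (toMat P * M * toMat Q⁻¹) := by
    rw [h, ← Matrix.mul_assoc (toMat P), scalarPow_mul_comm]
    simp only [scalarPow, Matrix.mul_assoc]
  have e2 : diagPow K (fun i => -μ i) =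
      diagPow K (fun _ => -β) * (toMat Q * M⁻¹ * toMat P⁻¹) := by
    rw [← diagPow_inv]
    apply Matrix.inv_eq_left_inv
    have e3 : diagPow K (fun _ : Fin r => -β) * (toMat Q * M⁻¹ * toMat P⁻¹) =
        toMat Q * M⁻¹ * toMat P⁻¹ * diagPow K (fun _ : Fin r => -β) :=
      (scalarPow_mul_comm (-β) _).symm
    rw [e3, e1, Matrix.mul_assoc, ← Matrix.mul_assoc (diagPow K _), diagPow_mul_diagPow]
    simp only [neg_add_cancel, diagPow_zero, Matrix.one_mul]
    rw [Matrix.mul_assoc, Matrix.mul_assoc (toMat P), ← Matrix.mul_assoc (toMat P⁻¹),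
      toMat_inv_mul, Matrix.one_mul, Matrix.mul_assoc, ← Matrix.mul_assoc M⁻¹,
      Matrix.nonsing_inv_mul _ ((Matrix.isUnit_iff_isUnit_det _).mp hM), Matrix.one_mul,
      toMat_mul_inv]
  -- The minors of size `1` of `M` bound `μ j - β` below, and those of `M⁻¹` bound `β - μ i` below;
  -- `β` cancels in the sum.
  have b1 : β + -C₁ ≤ μ j := by
    have h3 := (h₁ P Q⁻¹ 1 hr).1 (fun _ => j) (fun _ => j)
    have h4 := congrArg (fun A => ord (A j j)) e1
    simp only [diagPow_mul_apply] at h4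
    rw [diagPow, Matrix.diagonal_apply_eq, ord_tpow, ord_mul, ord_tpow] at h4
    rw [funMinorOrd_single] at h3
    have h5 := add_le_add_right h3 (β : WithTop ℝ)
    rw [← h4] at h5
    exact_mod_cast h5
  have b2 : -β + -C₂ ≤ -μ i := by
    have h3 := (h₂ Q P⁻¹ 1 hr).1 (fun _ => i) (fun _ => i)
    have h4 := congrArg (fun A => ord (A i i)) e2
    simp only [diagPow_mul_apply] at h4
    rw [diagPow, Matrix.diagonal_apply_eq, ord_tpow, ord_mul, ord_tpow] at h4
    rw [funMinorOrd_single] at h3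
    have h5 := add_le_add_right h3 ((-β : ℝ) : WithTop ℝ)
    rw [← h4] at h5
    exact_mod_cast h5
  linarith

end bounds

/-! ### Signs of the parts of a filling -/

section fillings

variable {K : Type*} [Field K] {r : ℕ}

theorem exists_sum_Iic_eq (F : Fin r → ℝ) : ∃ k : Fin r → ℝ, ∀ i, ∑ s ∈ Finset.Iic i, k s = F i := by
  induction r with
  | zero => exact ⟨F, fun i => i.elim0⟩
  | succ n ih =>
    obtain ⟨k, hk⟩ := ih fun i => F i.succ - F 0
    refine ⟨Fin.cons (F 0) k, Fin.cases ?_ fun i => ?_⟩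
    · rw [show (0 : Fin (n + 1)) = ⊥ from rfl, Finset.Iic_bot, Finset.sum_singleton]; rfl
    · have h1 : Finset.Iic i.succ =
          insert 0 ((Finset.Iic i).map (Fin.succEmb n)) := by
        ext x
        refine Fin.cases ?_ (fun x => ?_) x
        · simp
        · simp
      rw [h1, Finset.sum_insert (by simp), Finset.sum_map]
      simp only [Fin.coe_succEmb, Fin.cons_succ, Fin.cons_zero, hk]
      ring

theorem sum_Iic_succ (k : Fin r → ℝ) {i i' : Fin r} (h : (i : ℕ) = i' + 1) :
    ∑ s ∈ Finset.Iic i, k s = ∑ s ∈ Finset.Iic i', k s + k i := by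
  have h1 : Finset.Iic i = insert i (Finset.Iic i') := by
    ext x
    simp only [Finset.mem_Iic, Finset.mem_insert, Fin.le_def, Fin.ext_iff]
    omega
  rw [h1, Finset.sum_insert ?_, add_comm]
  rw [Finset.mem_Iic, Fin.le_def]
  omega

/-- The sets of rows obtained by adding elements to a set `G`, as ranges. -/
theorem mem_range_cons_orderEmb {G : Finset (Fin r)} {x y : Fin r} :
    y ∈ Set.range (Fin.cons x (G.orderEmbOfFin rfl) : Fin (G.card + 1) → Fin r) ↔
      y = x ∨ y ∈ G := by
  rw [Fin.range_cons, Finset.range_orderEmbOfFin, Set.mem_insert_iff, Finset.mem_coe]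

theorem injective_cons_orderEmb {G : Finset (Fin r)} {x : Fin r} (hx : x ∉ G) :
    Function.Injective (Fin.cons x (G.orderEmbOfFin rfl) : Fin (G.card + 1) → Fin r) :=
  Fin.cons_injective_iff.mpr ⟨by rwa [Finset.range_orderEmbOfFin], (G.orderEmbOfFin rfl).injective⟩

/-- All parts except the edge parts of a right filling are non-negative. -/
theorem IsMuGeneric.inner_part_nonneg {μ : Fin r → ℝ} {N Nstar : Mat r K}
    (h : IsMuGeneric μ N Nstar) (hN : IsUnit Nstar) {k : Fin r → Fin r → ℝ}
    (hk : ∀ i j : Fin r, i ≤ j → ∑ s ∈ Finset.Iic i, k s j =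
        rightOrd Nstar (omitRows r ((j : ℕ) - i) j) -
          rightOrd Nstar (omitRows r ((j : ℕ) - i + 1) ((j : ℕ) + 1)))
    {i j : Fin r} (hij : i < j) : 0 ≤ k i j := by
  have hne := fun (n : ℕ) (hn : n ≤ r) => h.right_minors_ne_top hN hn
  have hij' : (i : ℕ) < j := hij
  have hjr := j.2
  by_cases hi : (i : ℕ) = 0
  · have h1 := hk i j hij.le
    have h2 : Finset.Iic i = {i} := by
      ext x; simp only [Finset.mem_Iic, Finset.mem_singleton, Fin.le_def, Fin.ext_iff]; omega
    rw [h2, Finset.sum_singleton] at h1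
    rw [h1, sub_nonneg]
    -- In zero-based terms the two minors omit only row `j - 1` and only row `j`, so their row sets
    -- differ by exchanging `a` for `j`.
    let a : Fin r := ⟨j - 1, by omega⟩
    have haj : a < j := by rw [Fin.lt_def]; simp only [a]; omega
    let G : Finset (Fin r) := Finset.univ.filter fun x => x ≠ a ∧ x ≠ j
    have hja : j ∉ G := by simp [G]
    have haG : a ∉ G := by simp [G]
    have hm : G.card + 1 ≤ r := by
      simpa using Fintype.card_le_of_injective _ (injective_cons_orderEmb haG)
    have e1 := coe_rightOrd hm (injective_cons_orderEmb hja)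
      (I := omitRows r ((j : ℕ) - i) j) (fun x => by
        rw [mem_range_cons_orderEmb]
        simp only [omitRows, G, Finset.mem_filter, Finset.mem_univ, true_and, Fin.ext_iff, a,
          ne_eq]
        omega) (hne _ hm)
    have e2 := coe_rightOrd hm (injective_cons_orderEmb haG)
      (I := omitRows r ((j : ℕ) - i + 1) ((j : ℕ) + 1)) (fun x => by
        rw [mem_range_cons_orderEmb]
        simp only [omitRows, G, Finset.mem_filter, Finset.mem_univ, true_and, Fin.ext_iff, a,
          ne_eq]
        omega) (hne _ hm)
    have hle := h.right_minors_mono hm (injective_cons_orderEmb haG) (injective_cons_orderEmb hja)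
      (Fin.cases haj.le fun _ => le_rfl)
    rw [← e1, ← e2] at hle
    exact_mod_cast hle
  · let i' : Fin r := ⟨i - 1, by omega⟩
    have hi' : (i : ℕ) = i' + 1 := by simp only [i']; omega
    have h1 := hk i j hij.le
    have h2 := hk i' j (by rw [Fin.le_def]; omega)
    rw [sum_Iic_succ _ hi', h2] at h1
    let a : Fin r := ⟨j - i - 1, by omega⟩
    let b : Fin r := ⟨j - i, by omega⟩
    have hab : a < b := by rw [Fin.lt_def]; simp only [a, b]; omega
    have hbj : b < j := by rw [Fin.lt_def]; simp only [b]; omega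
    -- Subtracting consecutive partial sums leaves the row sets `G ∪ {j}`, `G ∪ {a}`, `G ∪ {a, j}`
    -- and `G ∪ {a, b}`, with signs `+ - - +`: exactly the combination in `three_term_le`.
    let G : Finset (Fin r) := Finset.univ.filter fun x => x < a ∨ j < x
    have hjG : j ∉ G := by simp [G, (hab.trans hbj).le]
    have haG : a ∉ G := by simp [G, (hab.trans hbj).le]
    have hbG : b ∉ G := by simp [G, hab.le, hbj.le]
    have inj2 : ∀ x y, x ≠ y → x ∉ G → y ∉ G → Function.Injective (Fin.cons x
        (Fin.cons y (G.orderEmbOfFin rfl) : Fin (G.card + 1) → Fin r) :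
          Fin (G.card + 2) → Fin r) :=
      fun x y hxy hx hy => Fin.cons_injective_iff.mpr
        ⟨fun hmem => (mem_range_cons_orderEmb.mp hmem).elim hxy hx, injective_cons_orderEmb hy⟩
    have hm : G.card + 2 ≤ r := by
      simpa [Nat.succ_le_iff] using Fintype.card_le_of_injective _ (inj2 a b hab.ne haG hbG)
    have hm' : G.card + 1 ≤ r := Nat.le_of_succ_le hm
    have e1 := coe_rightOrd hm' (injective_cons_orderEmb hjG)
      (I := omitRows r ((j : ℕ) - i) j) (fun x => by
        rw [mem_range_cons_orderEmb]
        simp only [omitRows, G, Finset.mem_filter, Finset.mem_univ, true_and, Fin.ext_iff,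
          Fin.lt_def, a]
        omega) (hne _ hm')
    have e2 := coe_rightOrd hm' (injective_cons_orderEmb haG)
      (I := omitRows r ((j : ℕ) - i + 1) ((j : ℕ) + 1)) (fun x => by
        rw [mem_range_cons_orderEmb]
        simp only [omitRows, G, Finset.mem_filter, Finset.mem_univ, true_and, Fin.ext_iff,
          Fin.lt_def, a]
        omega) (hne _ hm')
    have e3 := coe_rightOrd hm (inj2 a j (hab.trans hbj).ne haG hjG)
      (I := omitRows r ((j : ℕ) - i') j) (fun x => by
        rw [Fin.range_cons, Set.mem_insert_iff, mem_range_cons_orderEmb]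
        simp only [omitRows, G, Finset.mem_filter, Finset.mem_univ, true_and, Fin.ext_iff,
          Fin.lt_def, a, i']
        omega) (hne _ hm)
    have e4 := coe_rightOrd hm (inj2 a b hab.ne haG hbG)
      (I := omitRows r ((j : ℕ) - i' + 1) ((j : ℕ) + 1)) (fun x => by
        rw [Fin.range_cons, Set.mem_insert_iff, mem_range_cons_orderEmb]
        simp only [omitRows, G, Finset.mem_filter, Finset.mem_univ, true_and, Fin.ext_iff,
          Fin.lt_def, a, b, i']
        omega) (hne _ hm)
    have hle := h.three_term_le hm (S := G.orderEmbOfFin rfl) (G.orderEmbOfFin rfl).injective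
      hab hbj (by rwa [Finset.range_orderEmbOfFin]) (by rwa [Finset.range_orderEmbOfFin])
      (by rwa [Finset.range_orderEmbOfFin])
    rw [← e1, ← e2, ← e3, ← e4] at hle
    norm_cast at hle
    linarith

/-- The edge parts of a right filling. -/
theorem edge_part_eq {A : Mat r K} {k : Fin r → Fin r → ℝ}
    (hk : ∀ i j : Fin r, i ≤ j → ∑ s ∈ Finset.Iic i, k s j =
        rightOrd A (omitRows r ((j : ℕ) - i) j) -
          rightOrd A (omitRows r ((j : ℕ) - i + 1) ((j : ℕ) + 1))) (i : Fin r) :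
    k i i = rightOrd A (omitRows r 2 ((i : ℕ) + 1)) - rightOrd A (omitRows r 1 ((i : ℕ) + 1)) := by
  have h1 := hk i i le_rfl
  rw [Nat.sub_self, zero_add] at h1
  by_cases hi : (i : ℕ) = 0
  · have h2 : Finset.Iic i = {i} := by
      ext x; simp only [Finset.mem_Iic, Finset.mem_singleton, Fin.le_def, Fin.ext_iff]; omega
    have h3 : omitRows r 0 (i : ℕ) = omitRows r 2 ((i : ℕ) + 1) := by
      ext x; simp only [omitRows, Finset.mem_filter, Finset.mem_univ, true_and]; omega
    rw [h2, Finset.sum_singleton, h3] at h1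
    exact h1
  · let i' : Fin r := ⟨i - 1, by omega⟩
    have hi' : (i : ℕ) = i' + 1 := by simp only [i']; omega
    have h2 := hk i' i (by rw [Fin.le_def]; omega)
    -- No row has number `0`, so the sums up to `i` and up to `i - 1` share a minor, which cancels.
    have h3 : omitRows r 0 (i : ℕ) = omitRows r 1 (i : ℕ) := by
      ext x; simp only [omitRows, Finset.mem_filter, Finset.mem_univ, true_and]; omega
    have h4 : (i : ℕ) - i' = 1 := by omega
    rw [h4] at h2
    rw [sum_Iic_succ _ hi', h2, h3] at h1
    linarith

theorem exists_right_filling [Infinite K] {M : Mat r K} (hM : IsUnit M) (N : Mat r K) :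
    ∃ k, IsRightFilling M N k := by
  obtain ⟨μ, P, Q, hμ, hD⟩ := exists_diagPow hM
  obtain ⟨Nstar, hNs⟩ := exists_isMuGeneric hμ (toMat Q * N * toMat (1 : GLR r K)⁻¹)
  choose k hk using fun j : Fin r => exists_sum_Iic_eq fun i : Fin r =>
    rightOrd Nstar (omitRows r ((j : ℕ) - i) j) -
      rightOrd Nstar (omitRows r ((j : ℕ) - i + 1) ((j : ℕ) + 1))
  exact ⟨fun i j => k j i, μ, _, Nstar, hμ, ⟨P, Q, 1, hD, rfl⟩, hNs, fun i j _ => hk j i⟩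

/-- After scaling `N` by a large power of `t`, all parts of all right fillings are non-negative. -/
theorem exists_scaling_right_filling_nonneg {M N : Mat r K} (hM : IsUnit M) (hN : IsUnit N) :
    ∃ α : ℝ, ∀ β k, IsRightFilling (scalarPow r K β * M) (N * scalarPow r K α) k →
      AllPartsNonneg k := by
  obtain ⟨B, hB0, hB⟩ := exists_invariant_factor_bound hM
  obtain ⟨C, hC⟩ := exists_minor_bounds hN
  refine ⟨2 * C + r * B, fun β k => ?_⟩
  -- For `n ≤ r`, the two minors compared satisfy `ω_{n+1} ≥ (n + 1) α - C` and `ω_n ≤ n α + C + n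
  -- B`; this `α` absorbs the gap `2 C + n B`.
  set α := 2 * C + r * B with hα
  rintro ⟨μ, N', Nstar, hμ, ⟨P, Q₀, T₀, hD, hN'⟩, hgen, hk⟩ i j hij
  obtain ⟨Q, T, hNs⟩ : ∃ Q T : GLR r K, Nstar = toMat Q * N' * toMat T⁻¹ := by
    obtain ⟨-, Q, T, h, -⟩ := hgen
    exact ⟨Q, T, h⟩
  have hNα : Nstar = diagPow K (fun _ => α) * (toMat (Q * Q₀) * N * toMat (T₀⁻¹ * T⁻¹)) := by
    rw [hNs, hN', scalarPow_mul_comm, toMat_mul, toMat_mul]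
    have h1 := scalarPow_mul_comm α (toMat Q * toMat Q₀)
    rw [scalarPow] at h1 ⊢
    rw [Matrix.mul_assoc (toMat Q * toMat Q₀), ← Matrix.mul_assoc (diagPow K _), ← h1]
    simp only [Matrix.mul_assoc]
  have hunit : IsUnit Nstar := by
    rw [hNα]
    exact (isUnit_diagPow _).mul (((isUnit_toMat _).mul hN).mul (isUnit_toMat _))
  rcases lt_or_eq_of_le hij with hlt | rfl
  · exact hgen.inner_part_nonneg hunit hk hlt
  rw [edge_part_eq hk, sub_nonneg]
  have hlow : ∀ (n : ℕ), n ≤ r → ∀ p q : Fin n → Fin r,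
      ((n * α - C : ℝ) : WithTop ℝ) ≤ funMinorOrd Nstar p q := by
    intro n hn p q
    rw [hNα, funMinorOrd_diagPow_mul]
    refine le_trans (le_of_eq ?_) (add_le_add_right ((hC _ _ n hn).1 p q) _)
    rw [← WithTop.coe_add]; simp [sub_eq_add_neg]
  have hup : ∀ (n : ℕ), n ≤ r → ∃ I J : Fin n ↪o Fin r,
      funMinorOrd Nstar I J ≤ ((n * α + C : ℝ) : WithTop ℝ) := by
    intro n hn
    obtain ⟨I, J, h⟩ := (hC (Q * Q₀) (T₀⁻¹ * T⁻¹) n hn).2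
    refine ⟨I, J, ?_⟩
    rw [hNα, funMinorOrd_diagPow_mul]
    refine (add_le_add_right h _).trans (le_of_eq ?_)
    rw [← WithTop.coe_add]; simp
  have hi := i.2
  let z : Fin r := ⟨0, by omega⟩
  let G : Finset (Fin r) := Finset.univ.filter fun x => i < x
  have hzG : z ∉ G := fun h => absurd (Finset.mem_filter.mp h).2 (by simp [z, Fin.le_def])
  have hm : G.card + 1 ≤ r := by
    simpa using Fintype.card_le_of_injective _ (injective_cons_orderEmb hzG)
  have hm' : G.card ≤ r := Nat.le_of_succ_le hm
  have e1 := coe_rightOrd hm (injective_cons_orderEmb hzG)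
    (I := omitRows r 2 ((i : ℕ) + 1)) (fun x => by
      rw [mem_range_cons_orderEmb]
      simp only [omitRows, G, Finset.mem_filter, Finset.mem_univ, true_and, Fin.ext_iff,
        Fin.lt_def, z]
      omega) (hgen.right_minors_ne_top hunit hm)
  have e2 := coe_rightOrd hm' (p := G.orderEmbOfFin rfl) (G.orderEmbOfFin rfl).injective
    (I := omitRows r 1 ((i : ℕ) + 1)) (fun x => by
      rw [Finset.range_orderEmbOfFin]
      simp only [omitRows, G, Finset.mem_coe, Finset.mem_filter, Finset.mem_univ, true_and,
        Fin.lt_def]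
      omega) (hgen.right_minors_ne_top hunit hm')
  have h1 := hlow _ hm (Fin.cons z (G.orderEmbOfFin rfl)) (lastIdx hm)
  rw [← e1] at h1
  obtain ⟨I, J, hIJ⟩ := hup _ hm'
  -- The first rows form the smallest index set, so their right-most minor is bounded by the least
  -- of all minors. The second row inequality then moves from `I₀` to `G` at a cost of at most `B`
  -- per row.
  let I₀ : Fin G.card ↪o Fin r := Fin.castLEOrderEmb hm'
  have h2 : funMinorOrd Nstar I₀ (lastIdx hm') ≤ ((G.card * α + C : ℝ) : WithTop ℝ) :=
    ((hgen.right_minors hm').2 I₀ I (castLE_le hm' I)).1.trans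
      (((hgen.right_minors hm').1 I J).trans hIJ)
  have h3 := ((hgen.right_minors hm').2 I₀ (G.orderEmbOfFin rfl) (castLE_le hm' _)).2
  have h4 : ∑ a, μ (I₀ a) - ∑ a, μ (G.orderEmbOfFin rfl a) ≤ G.card * B := by
    rw [← Finset.sum_sub_distrib]
    refine (Finset.sum_le_card_nsmul _ _ B fun a _ => hB β μ P Q₀ hD _ _).trans ?_
    simp
  have h5 := h3.trans (add_le_add h2 (WithTop.coe_le_coe.mpr h4))
  rw [← e2] at h5
  norm_cast at h1 h5
  have h6 : (G.card : ℝ) * B ≤ r * B := by gcongr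
  push_cast at h1 h5
  linarith

end fillings

end LRFilling

/-! ### The theorem -/

theorem mainTheorem9 (K : Type*) [Field K] [CharZero K] (r : ℕ)
    (M N : Matrix (Fin r) (Fin r) (LRFilling.SeriesField K))
    (hM : IsUnit M) (hN : IsUnit N) :
    ∃ α β : ℝ,
      ((∃ k, LRFilling.IsRightFilling
          (LRFilling.scalarPow r K β * M) (N * LRFilling.scalarPow r K α) k) ∧
        ∀ k, LRFilling.IsRightFilling
          (LRFilling.scalarPow r K β * M) (N * LRFilling.scalarPow r K α) k →
            LRFilling.AllPartsNonneg k) ∧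
      ((∃ m, LRFilling.IsLeftFilling
          (LRFilling.scalarPow r K β * M) (N * LRFilling.scalarPow r K α) m) ∧
        ∀ m, LRFilling.IsLeftFilling
          (LRFilling.scalarPow r K β * M) (N * LRFilling.scalarPow r K α) m →
            LRFilling.AllPartsNonneg m) := by
  obtain ⟨α, hα⟩ := LRFilling.exists_scaling_right_filling_nonneg hM hN
  -- For the transposed pair `(Nᵀ, Mᵀ)` the roles of the scalings are exchanged: `β` scales the
  -- second matrix and is valid for every scaling `α` of the first.
  obtain ⟨β, hβ⟩ := LRFilling.exists_scaling_right_filling_nonneg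
    ((Matrix.isUnit_transpose _).mpr hN) ((Matrix.isUnit_transpose _).mpr hM)
  have hM' : IsUnit (LRFilling.scalarPow r K β * M) := (LRFilling.isUnit_diagPow _).mul hM
  have hN' : IsUnit (N * LRFilling.scalarPow r K α) := hN.mul (LRFilling.isUnit_diagPow _)
  refine ⟨α, β, ⟨LRFilling.exists_right_filling hM' _, hα β⟩,
    LRFilling.exists_right_filling ((Matrix.isUnit_transpose _).mpr hN') _, fun m hm => ?_⟩
  rw [LRFilling.IsLeftFilling, Matrix.transpose_mul, Matrix.transpose_mul, LRFilling.scalarPow,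
    LRFilling.scalarPow, LRFilling.transpose_diagPow, LRFilling.transpose_diagPow] at hm
  exact hβ α m hm
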